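/- Let $R$ be a ring with unit, $G$ a profinite group and $X$ a profinite space with a continuous left action of $G$. A \emph{$G$-sheaf of $R$-modules over $X$} is a local homeomorphism $p\colon E\to X$ from a space $E$ with a continuous $G$-action, such that $p$ is $G$-equivariant, each stalk $E_x=p^{-1}(x)$ is an $R$-module, the fibrewise subtraction $E\times_X E\to E$ and the multiplication $E\to E$ by each $r\in R$ are continuous, and each map $g\colon E_x\to E_{gx}$ is $R$-linear. Morphisms are the continuous $G$-equivariant maps over $X$ which are $R$-linear on stalks. For a topological group $H$, a \emph{discrete $R[H]$-module} is an $R$-module $M$ with an $R$-linear action of $H$ for which $H\times M\to M$ is continuous when $M$ has the discrete topology. For $x\in X$ let $\mathrm{Stab}(x)\le G$ be the stabiliser of $x$ and $i\colon Gx\to X$ the inclusion of the orbit of $x$. For a discrete $R[\mathrm{Stab}(x)]$-module $M$, let $G\times_{\mathrm{Stab}(x)}M$ be the quotient space of $G\times M$ by $(gh,m)\sim(g,hm)$ for $h\in\mathrm{Stab}(x)$, with the map $[g,m]\mapsto gx$ to $Gx$; this is a $G$-sheaf of $R$-modules over $Gx$. Its push forward $i_*(G\times_{\mathrm{Stab}(x)}M)$,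 the $G$-sheaf over $X$ whose sections over an open set $U$ are the sections over $i^{-1}(U)$, is the \emph{equivariant skyscraper} of $M$. 1. For every $x\in X$, the functor $E\mapsto E_x$ from $G$-sheaves of $R$-modules over $X$ to discrete $R[\mathrm{Stab}(x)]$-modules is left adjoint to the equivariant skyscraper functor $M\mapsto i_*(G\times_{\mathrm{Stab}(x)}M)$. 2. For every $x\in X$ and every injective discrete $R[\mathrm{Stab}(x)]$-module $A$, the equivariant skyscraper $i_*(G\times_{\mathrm{Stab}(x)}A)$ is injective in the category of $G$-sheaves of $R$-modules over $X$. 3. The adjunctions in (1) can be chosen such that the following holds. Let $E$ be a $G$-sheaf of $R$-modules over $X$ and choose a point $x_O$ in every orbit $O$ of $X$. There are monomorphisms $E_{x_O}\to I_O$ into injective discrete $R[\mathrm{Stab}(x_O)]$-modules, one for every orbit $O$. For any such monomorphisms, the product of the equivariant skyscrapers of the $I_O$ over all orbits $O$ exists in the category of $G$-sheaves of $R$-modules over $X$, it is injective, and the morphism from $E$ to it whose components are adjoint to the maps $E_{x_O}\to I_O$ is a monomorphism. 4. The category of $G$-sheaves of $R$-modules over $X$ has enough injectives. -/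

import Mathlib

open CategoryTheory CategoryTheory.Limits Filter Topology

universe u

set_option linter.unusedSectionVars false

namespace EquivSheaf

section FibreLemmas

/-! Let `F` be a family of sets over `X`; the total space of the family is `Σ x, F x`, with
projection `Sigma.fst`. -/

/-- The topology of the fibre product `E ×_X E ⊆ E × E` for `E = Σ x, F x`; the fibre product is
written as `Σ x, F x × F x`. -/
abbrev fibreSquareTop {X : Type u} (F : X → Type u) (t : TopologicalSpace (Σ x, F x)) :
    TopologicalSpace (Σ x, F x × F x) :=
  TopologicalSpace.induced
    (fun q => ((⟨q.1, q.2.1⟩, ⟨q.1, q.2.2⟩) : (Σ x, F x) × (Σ x, F x))) inferInstance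

theorem isLocalHomeomorph_of_sheets {T X : Type u} [TopologicalSpace T] [TopologicalSpace X]
    {p : T → X} (hc : Continuous p) (ho : IsOpenMap p)
    (hs : ∀ e, ∃ V : Set T, IsOpen V ∧ e ∈ V ∧ Set.InjOn p V) : IsLocalHomeomorph p := by
  rw [isLocalHomeomorph_iff_isOpenEmbedding_restrict]
  intro e
  obtain ⟨V, hV, he, hi⟩ := hs e
  refine ⟨V, hV.mem_nhds he, ?_⟩
  refine IsOpenEmbedding.of_continuous_injective_isOpenMap
    (hc.comp continuous_subtype_val) (Set.injOn_iff_injective.1 hi) ?_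
  exact ho.comp hV.isOpenEmbedding_subtypeVal.isOpenMap

theorem continuousAt_of_sheet {Z T X : Type u} [TopologicalSpace Z] [TopologicalSpace T]
    [TopologicalSpace X] {p : T → X} (hp : IsOpenMap p) {F : Z → T} {z : Z}
    (hF : ContinuousAt (fun z => p (F z)) z) {V : Set T} (hV : IsOpen V)
    (hi : Set.InjOn p V) (hz : ∀ᶠ z' in 𝓝 z, F z' ∈ V) : ContinuousAt F z := by
  intro W hW
  have hzV : F z ∈ V := hz.self_of_nhds
  have h1 : p '' (W ∩ V) ∈ 𝓝 (p (F z)) := hp.image_mem_nhds (inter_mem hW (hV.mem_nhds hzV))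
  have h0 : ∀ᶠ z' in 𝓝 z, p (F z') ∈ p '' (W ∩ V) := hF.eventually_mem h1
  change ∀ᶠ z' in 𝓝 z, F z' ∈ W
  filter_upwards [h0, hz] with z' h2 h3
  obtain ⟨e, ⟨heW, heV⟩, he⟩ := h2
  have : e = F z' := hi heV h3 he
  exact this ▸ heW

theorem eventually_eq_of_proj {Z T X : Type u} [TopologicalSpace Z] [TopologicalSpace T]
    [TopologicalSpace X] {p : T → X} (hp : IsLocalHomeomorph p) {a b : Z → T} {z : Z}
    (ha : ContinuousAt a z) (hb : ContinuousAt b z) (hab : ∀ z, p (a z) = p (b z))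
    (h : a z = b z) : ∀ᶠ z' in 𝓝 z, a z' = b z' := by
  obtain ⟨e, he, hpe⟩ := hp (a z)
  have h1 : e.source ∈ 𝓝 (a z) := e.open_source.mem_nhds he
  filter_upwards [ha h1, hb (h ▸ h1)] with z' h2 h3
  apply e.injOn h2 h3
  rw [← hpe]
  exact hab z'

end FibreLemmas

section Sheaves

variable (R G X : Type u) [Ring R] [Group G] [TopologicalSpace G] [TopologicalSpace X]
  [MulAction G X]

/-- A `G`-equivariant sheaf of `R`-modules over the `G`-space `X`, as a sheaf space `p : E → X`.
The space `E` is given as the disjoint union `Σ x, stalk x` of its fibres and `p` is the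
projection, so that a `G`-action on `E` for which `p` is equivariant is a family of maps
`stalk x → stalk (g • x)`. -/
structure GSheaf where
  /-- the fibre `p ⁻¹ {x}` -/
  stalk : X → Type u
  [addCommGroup : ∀ x, AddCommGroup (stalk x)]
  [module : ∀ x, Module R (stalk x)]
  /-- the topology of `E` -/
  [top : TopologicalSpace (Σ x, stalk x)]
  isLocalHomeomorph : IsLocalHomeomorph (Sigma.fst : (Σ x, stalk x) → X)
  continuous_sub : Continuous[fibreSquareTop stalk top, top] fun q => ⟨q.1, q.2.1 - q.2.2⟩
  continuous_smul : ∀ r : R,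
    Continuous fun e : Σ x, stalk x => (⟨e.1, r • e.2⟩ : Σ x, stalk x)
  /-- the map `g : stalk x → stalk (g • x)`, which is `R`-linear; its target is written `stalk y`
  with a proof of `g • x = y` -/
  act : ∀ (g : G) (x y : X), g • x = y → (stalk x →ₗ[R] stalk y)
  act_one : ∀ (x : X) (h : (1 : G) • x = x) (e : stalk x), act 1 x x h e = e
  act_mul : ∀ (g k : G) (x y z : X) (hk : k • x = y) (hg : g • y = z) (hgk : (g * k) • x = z)
    (e : stalk x), act (g * k) x z hgk e = act g y z hg (act k x y hk e)
  continuous_act : Continuous fun q : G × (Σ x, stalk x) =>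
    (⟨q.1 • q.2.1, act q.1 q.2.1 (q.1 • q.2.1) rfl q.2.2⟩ : Σ x, stalk x)

attribute [instance] GSheaf.addCommGroup GSheaf.module GSheaf.top

variable {R G X}

/-- The total space `E` of the sheaf space `p : E → X`. -/
abbrev GSheaf.Total (E : GSheaf R G X) : Type u := Σ x, E.stalk x

/-- A map of `G`-sheaves of `R`-modules over `X`: a continuous `G`-equivariant map over `X` which
is `R`-linear on the fibres. -/
@[ext]
structure GSheaf.Hom (E F : GSheaf R G X) where
  app : ∀ x, E.stalk x →ₗ[R] F.stalk x
  continuous_app : Continuous fun e : E.Total => (⟨e.1, app e.1 e.2⟩ : F.Total)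
  app_act : ∀ (g : G) (x y : X) (h : g • x = y) (e : E.stalk x),
    app y (E.act g x y h e) = F.act g x y h (app x e)

instance : Category (GSheaf R G X) where
  Hom E F := GSheaf.Hom E F
  id E := ⟨fun _ => LinearMap.id, continuous_id, fun _ _ _ _ _ => rfl⟩
  comp f g := ⟨fun x => (g.app x).comp (f.app x), g.continuous_app.comp f.continuous_app,
    fun k x y h e => by simp [f.app_act, g.app_act]⟩

@[ext]
theorem GSheaf.hom_ext {E F : GSheaf R G X} (f g : E ⟶ F)
    (h : ∀ x e, f.app x e = g.app x e) : f = g :=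
  GSheaf.Hom.ext (funext fun x => LinearMap.ext (h x))

@[simp]
theorem GSheaf.id_app (E : GSheaf R G X) (x : X) : GSheaf.Hom.app (𝟙 E) x = LinearMap.id := rfl

@[simp]
theorem GSheaf.comp_app {E F K : GSheaf R G X} (f : E ⟶ F) (g : F ⟶ K) (x : X) :
    GSheaf.Hom.app (f ≫ g) x = (g.app x).comp (f.app x) := rfl

theorem GSheaf.act_congr (E : GSheaf R G X) (s : ∀ x, E.stalk x) {g g' : G} {x x' y : X}
    (hg : g = g') (hx : x = x') (h : g • x = y) (h' : g' • x' = y) :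
    E.act g x y h (s x) = E.act g' x' y h' (s x') := by
  subst hg hx; rfl

theorem GSheaf.act_total (E : GSheaf R G X) (g : G) (x y : X) (h : g • x = y) (e : E.stalk x) :
    (⟨y, E.act g x y h e⟩ : E.Total) = ⟨g • x, E.act g x (g • x) rfl e⟩ := by
  subst h; rfl

theorem GSheaf.isOpenQuotientMap_fst (E : GSheaf R G X) :
    IsOpenQuotientMap (Sigma.fst : E.Total → X) :=
  ⟨fun x => ⟨⟨x, 0⟩, rfl⟩, E.isLocalHomeomorph.continuous, E.isLocalHomeomorph.isOpenMap⟩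

theorem GSheaf.continuousAt_sub (E : GSheaf R G X) {s t : ∀ x, E.stalk x} {x : X}
    (hs : ContinuousAt (fun x => (⟨x, s x⟩ : E.Total)) x)
    (ht : ContinuousAt (fun x => (⟨x, t x⟩ : E.Total)) x) :
    ContinuousAt (fun x => (⟨x, (s - t) x⟩ : E.Total)) x := by
  let _ := fibreSquareTop E.stalk E.top
  have h : ContinuousAt (fun x => (⟨x, (s x, t x)⟩ : Σ x, E.stalk x × E.stalk x)) x := by
    rw [ContinuousAt, nhds_induced, tendsto_comap_iff]
    exact hs.prodMk ht
  exact E.continuous_sub.continuousAt.comp h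

theorem GSheaf.continuous_zero (E : GSheaf R G X) :
    Continuous (fun x => (⟨x, 0⟩ : E.Total)) := by
  let _ := fibreSquareTop E.stalk E.top
  have h : Continuous (fun e : E.Total => (⟨e.1, (e.2, e.2)⟩ : Σ x, E.stalk x × E.stalk x)) := by
    rw [continuous_induced_rng]
    exact continuous_id.prodMk continuous_id
  rw [← E.isOpenQuotientMap_fst.continuous_comp_iff]
  have := E.continuous_sub.comp h
  simpa [Function.comp_def] using this

theorem GSheaf.continuousAt_add (E : GSheaf R G X) {s t : ∀ x, E.stalk x} {x : X}
    (hs : ContinuousAt (fun x => (⟨x, s x⟩ : E.Total)) x)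
    (ht : ContinuousAt (fun x => (⟨x, t x⟩ : E.Total)) x) :
    ContinuousAt (fun x => (⟨x, (s + t) x⟩ : E.Total)) x := by
  have h := E.continuousAt_sub hs (E.continuousAt_sub (s := 0) E.continuous_zero.continuousAt ht)
  rwa [zero_sub, sub_neg_eq_add] at h

/-- The translate `g * s = g ∘ s ∘ g⁻¹` of a section. -/
def GSheaf.translate (E : GSheaf R G X) (g : G) : (∀ x, E.stalk x) →ₗ[R] (∀ x, E.stalk x) where
  toFun s := fun x => E.act g (g⁻¹ • x) x (smul_inv_smul g x) (s (g⁻¹ • x))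
  map_add' s t := by ext x; simp
  map_smul' r s := by ext x; simp

theorem GSheaf.translate_apply (E : GSheaf R G X) (g : G) (s : ∀ x, E.stalk x) {x y : X}
    (h : g • x = y) : E.translate g s y = E.act g x y h (s x) :=
  E.act_congr s rfl (by rw [← h, inv_smul_smul]) _ _

theorem GSheaf.translate_one (E : GSheaf R G X) (s : ∀ x, E.stalk x) : E.translate 1 s = s := by
  ext x
  rw [E.translate_apply 1 s (one_smul G x), E.act_one]

theorem GSheaf.translate_mul (E : GSheaf R G X) (g k : G) (s : ∀ x, E.stalk x) :
    E.translate (g * k) s = E.translate g (E.translate k s) := by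
  ext x
  rw [E.translate_apply (g * k) s (x := k⁻¹ • g⁻¹ • x) (by simp [mul_smul]),
    E.translate_apply g _ (x := g⁻¹ • x) (by simp),
    E.translate_apply k s (x := k⁻¹ • g⁻¹ • x) (by simp)]
  exact E.act_mul _ _ _ _ _ _ _ _ _

end Sheaves

section PushForward

variable {R G X Y : Type u} [Ring R] [Group G] [TopologicalSpace G]
  [TopologicalSpace X] [TopologicalSpace Y] [MulAction G Y]

/-- The set-theoretic sections of `E` over `Y` which are continuous on `f ⁻¹ U` for some
neighbourhood `U` of `x`. Up to its (arbitrary) values off `f ⁻¹ U`, such a section is an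
element of `Γ(f ⁻¹ U, E)`, that is, a section over `U` of the push forward presheaf. -/
def sectionsNear (E : GSheaf R G Y) (f : Y → X) (x : X) : Submodule R (∀ y, E.stalk y) where
  carrier := {s | ∀ᶠ y in comap f (𝓝 x), ContinuousAt (fun y => (⟨y, s y⟩ : E.Total)) y}
  zero_mem' := Set.mem_ofPred_eq ▸ Eventually.of_forall fun _ => E.continuous_zero.continuousAt
  add_mem' hs ht := by
    rw [Set.mem_ofPred_eq] at hs ht ⊢
    filter_upwards [hs, ht] with y h1 h2 using E.continuousAt_add h1 h2
  smul_mem' r s hs := by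
    rw [Set.mem_ofPred_eq] at hs ⊢
    filter_upwards [hs] with y h
    exact (E.continuous_smul r).continuousAt.comp h

/-- The set-theoretic sections which vanish on `f ⁻¹ U` for some neighbourhood `U` of `x`. -/
def zeroNear (E : GSheaf R G Y) (f : Y → X) (x : X) : Submodule R (∀ y, E.stalk y) where
  carrier := {s | ∀ᶠ y in comap f (𝓝 x), s y = 0}
  zero_mem' := Set.mem_ofPred_eq ▸ Eventually.of_forall fun _ => rfl
  add_mem' hs ht := by
    rw [Set.mem_ofPred_eq] at hs ht ⊢
    filter_upwards [hs, ht] with y h1 h2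
    simp [h1, h2]
  smul_mem' r s hs := by
    rw [Set.mem_ofPred_eq] at hs ⊢
    filter_upwards [hs] with y h
    simp [h]

/-- The stalk at `x` of the presheaf `U ↦ Γ(f ⁻¹ U, E)`: the germs at `x` of its sections. -/
abbrev PushStalk (E : GSheaf R G Y) (f : Y → X) (x : X) : Type u :=
  sectionsNear E f x ⧸ (zeroNear E f x).submoduleOf (sectionsNear E f x)

/-- The germ at `x` of a section. -/
def germ (E : GSheaf R G Y) (f : Y → X) (x : X) (s : sectionsNear E f x) : PushStalk E f x :=
  Submodule.Quotient.mk s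

theorem germ_eq_iff (E : GSheaf R G Y) (f : Y → X) (x : X) (s t : sectionsNear E f x) :
    germ E f x s = germ E f x t ↔ ∀ᶠ y in comap f (𝓝 x), s.1 y = t.1 y := by
  rw [germ, germ, Submodule.Quotient.eq]
  have : (∀ᶠ y in comap f (𝓝 x), s.1 y = t.1 y) ↔
      ∀ᶠ y in comap f (𝓝 x), (s - t).1 y = 0 :=
    eventually_congr (Eventually.of_forall fun y => by simp [sub_eq_zero])
  rw [this]
  rfl

theorem germ_surj (E : GSheaf R G Y) (f : Y → X) (x : X) (e : PushStalk E f x) :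
    ∃ s, germ E f x s = e :=
  Submodule.Quotient.mk_surjective _ e

/-- The set `B(s, U)` of the germs at the points of `U` of a section `s` over `U`. -/
def sheet (E : GSheaf R G Y) (f : Y → X) (U : Set X) (s : ∀ y, E.stalk y)
    (hs : ∀ x ∈ U, s ∈ sectionsNear E f x) : Set (Σ x, PushStalk E f x) :=
  Set.range fun x : U => ⟨x.1, germ E f x.1 ⟨s, hs x.1 x.2⟩⟩

/-- The usual topology on the space of germs, generated by the sets `B(s, U)` for `U` open. -/
instance pushTop (E : GSheaf R G Y) (f : Y → X) : TopologicalSpace (Σ x, PushStalk E f x) :=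
  TopologicalSpace.generateFrom
    {W | ∃ (U : Set X) (s : ∀ y, E.stalk y) (hs : ∀ x ∈ U, s ∈ sectionsNear E f x),
      IsOpen U ∧ W = sheet E f U s hs}

theorem isOpen_sheet (E : GSheaf R G Y) (f : Y → X) {U : Set X} (hU : IsOpen U)
    (s : ∀ y, E.stalk y) (hs : ∀ x ∈ U, s ∈ sectionsNear E f x) :
    IsOpen (sheet E f U s hs) :=
  TopologicalSpace.isOpen_generateFrom_of_mem ⟨U, s, hs, hU, rfl⟩

theorem mem_sheet (E : GSheaf R G Y) (f : Y → X) {U : Set X} (s : ∀ y, E.stalk y)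
    (hs : ∀ x ∈ U, s ∈ sectionsNear E f x) (x : X) (t : sectionsNear E f x) :
    (⟨x, germ E f x t⟩ : Σ x, PushStalk E f x) ∈ sheet E f U s hs ↔
      x ∈ U ∧ ∀ᶠ y in comap f (𝓝 x), t.1 y = s y := by
  constructor
  · rintro ⟨⟨x', hx'⟩, h⟩
    obtain rfl : x' = x := congrArg Sigma.fst h
    refine ⟨hx', ?_⟩
    have h2 := eq_of_heq (Sigma.mk.inj h).2
    exact ((germ_eq_iff _ _ _ _ _).1 h2).mono fun _ h => h.symm
  · rintro ⟨hx, h⟩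
    refine ⟨⟨x, hx⟩, ?_⟩
    have := (germ_eq_iff E f x ⟨s, hs x hx⟩ t).2 (h.mono fun _ h => h.symm)
    simp only [this]

theorem injOn_sheet (E : GSheaf R G Y) (f : Y → X) {U : Set X} (s : ∀ y, E.stalk y)
    (hs : ∀ x ∈ U, s ∈ sectionsNear E f x) :
    Set.InjOn (Sigma.fst : (Σ x, PushStalk E f x) → X) (sheet E f U s hs) := by
  rintro _ ⟨⟨x, hx⟩, rfl⟩ _ ⟨⟨x', hx'⟩, rfl⟩ h
  obtain rfl : x = x' := h
  rfl

theorem eventually_comap_nhds {f : Y → X} {x : X} {P : Y → Prop}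
    (h : ∀ᶠ y in comap f (𝓝 x), P y) :
    ∃ U : Set X, IsOpen U ∧ x ∈ U ∧ ∀ x' ∈ U, ∀ᶠ y in comap f (𝓝 x'), P y := by
  rw [eventually_comap, eventually_nhds_iff] at h
  obtain ⟨U, hU, ho, hx⟩ := h
  refine ⟨U, ho, hx, fun x' hx' => ?_⟩
  rw [eventually_comap]
  filter_upwards [ho.mem_nhds hx'] with z hz using hU z hz

theorem isOpen_push_iff (E : GSheaf R G Y) (f : Y → X) (V : Set (Σ x, PushStalk E f x)) :
    IsOpen V ↔ ∀ (x : X) (s : sectionsNear E f x), (⟨x, germ E f x s⟩ : Σ z, PushStalk E f z) ∈ V →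
      ∃ (U : Set X) (hs : ∀ x' ∈ U, s.1 ∈ sectionsNear E f x'),
        IsOpen U ∧ x ∈ U ∧ sheet E f U s.1 hs ⊆ V := by
  constructor
  · intro h
    induction h with
    | basic W hW =>
      obtain ⟨U, t, ht, hU, rfl⟩ := hW
      intro x s hs
      rw [mem_sheet] at hs
      obtain ⟨U₁, ho₁, hx₁, h₁⟩ := eventually_comap_nhds hs.2
      obtain ⟨U₂, ho₂, hx₂, h₂⟩ := eventually_comap_nhds s.2
      refine ⟨U ∩ U₁ ∩ U₂, fun x' hx' => h₂ x' hx'.2, (hU.inter ho₁).inter ho₂,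
        ⟨⟨hs.1, hx₁⟩, hx₂⟩, ?_⟩
      rintro _ ⟨⟨x', hx'⟩, rfl⟩
      rw [mem_sheet]
      exact ⟨hx'.1.1, h₁ x' hx'.1.2⟩
    | univ =>
      intro x s _
      obtain ⟨U₂, ho₂, hx₂, h₂⟩ := eventually_comap_nhds s.2
      exact ⟨U₂, h₂, ho₂, hx₂, Set.subset_univ _⟩
    | inter A B _ _ hA hB =>
      intro x s hs
      obtain ⟨U₁, hs₁, ho₁, hx₁, h₁⟩ := hA x s hs.1
      obtain ⟨U₂, hs₂, ho₂, hx₂, h₂⟩ := hB x s hs.2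
      refine ⟨U₁ ∩ U₂, fun x hx => hs₁ x hx.1, ho₁.inter ho₂, ⟨hx₁, hx₂⟩, ?_⟩
      rintro _ ⟨⟨x', hx'⟩, rfl⟩
      exact ⟨h₁ ⟨⟨x', hx'.1⟩, rfl⟩, h₂ ⟨⟨x', hx'.2⟩, rfl⟩⟩
    | sUnion S _ hS =>
      rintro x s ⟨A, hA, hs⟩
      obtain ⟨U, hs, ho, hx, h⟩ := hS A hA x s hs
      exact ⟨U, hs, ho, hx, h.trans (Set.subset_sUnion_of_mem hA)⟩
  · intro h
    rw [isOpen_iff_forall_mem_open]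
    rintro ⟨x, e⟩ he
    obtain ⟨s, rfl⟩ := germ_surj E f x e
    obtain ⟨U, hs, ho, hx, hsub⟩ := h x s he
    exact ⟨_, hsub, isOpen_sheet E f ho s.1 hs, ⟨⟨x, hx⟩, rfl⟩⟩

theorem exists_sheet (E : GSheaf R G Y) (f : Y → X) (x : X) (s : sectionsNear E f x) :
    ∃ (U : Set X) (_ : ∀ x ∈ U, s.1 ∈ sectionsNear E f x), IsOpen U ∧ x ∈ U := by
  obtain ⟨U, ho, hx, h⟩ := eventually_comap_nhds s.2
  exact ⟨U, h, ho, hx⟩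

theorem push_continuous_fst (E : GSheaf R G Y) (f : Y → X) :
    Continuous (Sigma.fst : (Σ x, PushStalk E f x) → X) := by
  refine ⟨fun V hV => ?_⟩
  rw [isOpen_push_iff]
  intro x s hx
  obtain ⟨U, hs, ho, hxU⟩ := exists_sheet E f x s
  refine ⟨U ∩ V, fun x hx => hs x hx.1, ho.inter hV, ⟨hxU, hx⟩, ?_⟩
  rintro _ ⟨⟨x', hx'⟩, rfl⟩
  exact hx'.2

theorem push_isOpenMap_fst (E : GSheaf R G Y) (f : Y → X) :
    IsOpenMap (Sigma.fst : (Σ x, PushStalk E f x) → X) := by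
  intro V hV
  rw [isOpen_push_iff] at hV
  rw [isOpen_iff_forall_mem_open]
  rintro _ ⟨⟨x, e⟩, he, rfl⟩
  obtain ⟨s, rfl⟩ := germ_surj E f x e
  obtain ⟨U, hs, ho, hx, hsub⟩ := hV x s he
  exact ⟨U, fun x' hx' => ⟨_, hsub ⟨⟨x', hx'⟩, rfl⟩, rfl⟩, ho, hx⟩

theorem push_isLocalHomeomorph (E : GSheaf R G Y) (f : Y → X) :
    IsLocalHomeomorph (Sigma.fst : (Σ x, PushStalk E f x) → X) := by
  refine isLocalHomeomorph_of_sheets (push_continuous_fst E f) (push_isOpenMap_fst E f) ?_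
  rintro ⟨x, e⟩
  obtain ⟨s, rfl⟩ := germ_surj E f x e
  obtain ⟨U, hs, ho, hx⟩ := exists_sheet E f x s
  exact ⟨_, isOpen_sheet E f ho s.1 hs, ⟨⟨x, hx⟩, rfl⟩, injOn_sheet E f s.1 hs⟩

theorem push_continuous_sub (E : GSheaf R G Y) (f : Y → X) :
    Continuous[fibreSquareTop (PushStalk E f) (pushTop E f), pushTop E f]
      fun q => ⟨q.1, q.2.1 - q.2.2⟩ := by
  let _ := fibreSquareTop (PushStalk E f) (pushTop E f)
  rw [continuous_iff_continuousAt]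
  rintro ⟨x, e₁, e₂⟩
  obtain ⟨s, rfl⟩ := germ_surj E f x e₁
  obtain ⟨t, rfl⟩ := germ_surj E f x e₂
  obtain ⟨U₁, hs, ho₁, hx₁⟩ := exists_sheet E f x s
  obtain ⟨U₂, ht, ho₂, hx₂⟩ := exists_sheet E f x t
  have hst : ∀ x ∈ U₁ ∩ U₂, s.1 - t.1 ∈ sectionsNear E f x :=
    fun x hx => sub_mem (hs x hx.1) (ht x hx.2)
  have hi : Continuous (fun q : Σ x, PushStalk E f x × PushStalk E f x =>
      ((⟨q.1, q.2.1⟩, ⟨q.1, q.2.2⟩) : (Σ x, PushStalk E f x) × (Σ x, PushStalk E f x))) :=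
    continuous_induced_dom
  refine continuousAt_of_sheet (push_isOpenMap_fst E f) ?_
    (isOpen_sheet E f (ho₁.inter ho₂) _ hst) (injOn_sheet E f _ hst) ?_
  · exact ((push_continuous_fst E f).comp (continuous_fst.comp hi)).continuousAt
  · have hW := ((isOpen_sheet E f ho₁ s.1 hs).prod (isOpen_sheet E f ho₂ t.1 ht)).preimage hi
    filter_upwards [hW.mem_nhds ⟨⟨⟨x, hx₁⟩, rfl⟩, ⟨⟨x, hx₂⟩, rfl⟩⟩]
    rintro ⟨x', e₁, e₂⟩ ⟨h₁, h₂⟩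
    obtain ⟨s', rfl⟩ := germ_surj E f x' e₁
    obtain ⟨t', rfl⟩ := germ_surj E f x' e₂
    rw [mem_sheet] at h₁ h₂
    refine (mem_sheet E f _ hst x' (s' - t')).2 ⟨⟨h₁.1, h₂.1⟩, ?_⟩
    filter_upwards [h₁.2, h₂.2] with y h₃ h₄
    simp [h₃, h₄]

theorem push_continuous_smul (E : GSheaf R G Y) (f : Y → X) (r : R) :
    Continuous fun e : Σ x, PushStalk E f x => (⟨e.1, r • e.2⟩ : Σ x, PushStalk E f x) := by
  rw [continuous_iff_continuousAt]
  rintro ⟨x, e⟩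
  obtain ⟨s, rfl⟩ := germ_surj E f x e
  obtain ⟨U, hs, ho, hx⟩ := exists_sheet E f x s
  have hst : ∀ x ∈ U, r • s.1 ∈ sectionsNear E f x := fun x hx => Submodule.smul_mem _ r (hs x hx)
  refine continuousAt_of_sheet (push_isOpenMap_fst E f) (push_continuous_fst E f).continuousAt
    (isOpen_sheet E f ho _ hst) (injOn_sheet E f _ hst) ?_
  filter_upwards [(isOpen_sheet E f ho s.1 hs).mem_nhds ⟨⟨x, hx⟩, rfl⟩]
  rintro ⟨x', e⟩ h₁
  obtain ⟨s', rfl⟩ := germ_surj E f x' e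
  rw [mem_sheet] at h₁
  refine (mem_sheet E f _ hst x' (r • s')).2 ⟨h₁.1, ?_⟩
  filter_upwards [h₁.2] with y h₃
  simp [h₃]

/-! From here on the map `f` is equivariant and the actions are continuous. -/

variable [MulAction G X] [IsTopologicalGroup G] [ContinuousSMul G X] [ContinuousSMul G Y]

theorem tendsto_translate {f : Y → X} (hf : ∀ (g : G) y, f (g • y) = g • f y) (g : G) {x x' : X}
    (h : g • x = x') : Tendsto (fun y : Y => g⁻¹ • y) (comap f (𝓝 x')) (comap f (𝓝 x)) := by
  rw [tendsto_comap_iff]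
  have h1 : f ∘ (fun y : Y => g⁻¹ • y) = (fun z : X => g⁻¹ • z) ∘ f := by
    ext y; simp [hf]
  have h2 : Tendsto (fun z : X => g⁻¹ • z) (𝓝 x') (𝓝 x) := by
    have := (continuous_const_smul (g⁻¹ : G)).tendsto x'
    rwa [← h, inv_smul_smul, h] at this
  rw [h1]
  exact h2.comp tendsto_comap

theorem continuousAt_translate (E : GSheaf R G Y) (g : G) {s : ∀ y, E.stalk y} {y : Y}
    (h : ContinuousAt (fun y => (⟨y, s y⟩ : E.Total)) (g⁻¹ • y)) :
    ContinuousAt (fun y => (⟨y, E.translate g s y⟩ : E.Total)) y := by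
  have h1 : (fun y => (⟨y, E.translate g s y⟩ : E.Total)) =
      fun y => (⟨g • (g⁻¹ • y), E.act g (g⁻¹ • y) _ rfl (s (g⁻¹ • y))⟩ : E.Total) := by
    ext1 y
    exact E.act_total _ _ _ _ _
  rw [h1]
  have h2 : ContinuousAt (fun y => ((g, ⟨g⁻¹ • y, s (g⁻¹ • y)⟩) : G × E.Total)) y :=
    continuousAt_const.prodMk
      (ContinuousAt.comp (f := fun y : Y => g⁻¹ • y) h (continuous_const_smul g⁻¹).continuousAt)
  exact ContinuousAt.comp (f := fun y => ((g, ⟨g⁻¹ • y, s (g⁻¹ • y)⟩) : G × E.Total))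
    E.continuous_act.continuousAt h2

theorem translate_mem (E : GSheaf R G Y) {f : Y → X} (hf : ∀ (g : G) y, f (g • y) = g • f y)
    (g : G) {x x' : X} (h : g • x = x') {s : ∀ y, E.stalk y} (hs : s ∈ sectionsNear E f x) :
    E.translate g s ∈ sectionsNear E f x' :=
  ((tendsto_translate hf g h).eventually hs).mono fun _ hy => continuousAt_translate E g hy

theorem translate_mem_zero (E : GSheaf R G Y) {f : Y → X} (hf : ∀ (g : G) y, f (g • y) = g • f y)
    (g : G) {x x' : X} (h : g • x = x') {s : ∀ y, E.stalk y} (hs : s ∈ zeroNear E f x) :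
    E.translate g s ∈ zeroNear E f x' :=
  ((tendsto_translate hf g h).eventually hs).mono fun y hy => by
    change E.act g _ _ _ (s (g⁻¹ • y)) = 0
    rw [hy, map_zero]

/-- The action on germs, `g (s_x) = (g * s)_{g x}`. -/
def pushAct (E : GSheaf R G Y) {f : Y → X} (hf : ∀ (g : G) y, f (g • y) = g • f y)
    (g : G) (x x' : X) (h : g • x = x') : PushStalk E f x →ₗ[R] PushStalk E f x' :=
  Submodule.mapQ _ _
    ((E.translate g).restrict fun _ hs => translate_mem E hf g h hs)
    fun _ hs => translate_mem_zero E hf g h hs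

theorem pushAct_germ (E : GSheaf R G Y) {f : Y → X} (hf : ∀ (g : G) y, f (g • y) = g • f y)
    (g : G) (x x' : X) (h : g • x = x') (s : sectionsNear E f x) :
    pushAct E hf g x x' h (germ E f x s) =
      germ E f x' ⟨E.translate g s.1, translate_mem E hf g h s.2⟩ :=
  rfl

/-- A section is locally invariant under the translations by elements near `1`. -/
theorem eventually_translate_eq [CompactSpace Y] [T2Space X] (E : GSheaf R G Y) {f : Y → X}
    (hc : Continuous f) {x : X} {s : ∀ y, E.stalk y} (hs : s ∈ sectionsNear E f x) :
    ∀ᶠ q : G × Y in 𝓝 1 ×ˢ comap f (𝓝 x), E.translate q.1 s q.2 = s q.2 := by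
  have hcl : IsClosedMap f := hc.isClosedMap
  have hK : IsCompact (f ⁻¹' {x}) := (isClosed_singleton.preimage hc).isCompact
  have hcomap : comap f (𝓝 x) = 𝓝ˢ (f ⁻¹' {x}) := hcl.comap_nhds_eq hc x
  rw [hcomap]
  have hs' : ∀ y ∈ f ⁻¹' {x}, ContinuousAt (fun y => (⟨y, s y⟩ : E.Total)) y := by
    intro y hy
    have : ∀ᶠ y in 𝓝ˢ (f ⁻¹' {x}), ContinuousAt (fun y => (⟨y, s y⟩ : E.Total)) y := by
      rw [← hcomap]; exact hs
    exact this.self_of_nhdsSet y hy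
  have key : ∀ᶠ q : G × Y in 𝓝 1 ×ˢ 𝓝ˢ (f ⁻¹' {x}), E.translate q.1 s q.2 = s q.2 := by
    have h1 : ∀ y ∈ f ⁻¹' {x}, ∀ᶠ q : G × Y in 𝓝 (1, y), E.translate q.1 s q.2 = s q.2 := by
      intro y hy
      have hsy := hs' y hy
      have ha : ContinuousAt
          (fun q : G × Y => (⟨q.2, E.translate q.1 s q.2⟩ : E.Total)) (1, y) := by
        have h2 : (fun q : G × Y => (⟨q.2, E.translate q.1 s q.2⟩ : E.Total)) =
            fun q => ⟨q.1 • (q.1⁻¹ • q.2), E.act q.1 (q.1⁻¹ • q.2) _ rfl (s (q.1⁻¹ • q.2))⟩ := by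
          ext1 q
          exact E.act_total _ _ _ _ _
        rw [h2]
        have h3 : ContinuousAt (fun q : G × Y => q.1⁻¹ • q.2) (1, y) :=
          (continuous_fst.inv.smul continuous_snd).continuousAt
        have h4 : ContinuousAt
            (fun q : G × Y => (⟨q.1⁻¹ • q.2, s (q.1⁻¹ • q.2)⟩ : E.Total)) (1, y) := by
          refine ContinuousAt.comp (f := fun q : G × Y => q.1⁻¹ • q.2)
            (g := fun y => (⟨y, s y⟩ : E.Total)) ?_ h3
          simpa using hsy
        exact ContinuousAt.comp
          (f := fun q : G × Y => ((q.1, ⟨q.1⁻¹ • q.2, s (q.1⁻¹ • q.2)⟩) : G × E.Total))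
          E.continuous_act.continuousAt (continuousAt_fst.prodMk h4)
      have hb : ContinuousAt (fun q : G × Y => (⟨q.2, s q.2⟩ : E.Total)) (1, y) :=
        ContinuousAt.comp (f := fun q : G × Y => q.2)
          (g := fun y => (⟨y, s y⟩ : E.Total)) hsy continuousAt_snd
      have h5 := eventually_eq_of_proj E.isLocalHomeomorph ha hb (fun _ => rfl)
        (by simp [E.translate_one])
      filter_upwards [h5] with q hq
      exact eq_of_heq (Sigma.mk.inj hq).2
    have h2 := hK.mem_prod_nhdsSet_of_forall (l := 𝓝 (1 : G))
      (s := {q : G × Y | E.translate q.1 s q.2 = s q.2}) (fun y hy => by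
        have := h1 y hy
        rw [nhds_prod_eq] at this
        exact this)
    exact h2
  exact key

theorem push_continuous_act [CompactSpace Y] [T2Space X] (E : GSheaf R G Y) {f : Y → X}
    (hf : ∀ (g : G) y, f (g • y) = g • f y) (hc : Continuous f) :
    Continuous fun q : G × (Σ x, PushStalk E f x) =>
      (⟨q.1 • q.2.1, pushAct E hf q.1 q.2.1 (q.1 • q.2.1) rfl q.2.2⟩ :
        Σ x, PushStalk E f x) := by
  rw [continuous_iff_continuousAt]
  rintro ⟨g, ⟨x, e⟩⟩
  obtain ⟨s, rfl⟩ := germ_surj E f x e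
  obtain ⟨N, hN, W, hW, hNW⟩ := mem_prod_iff.1 (eventually_translate_eq E hc s.2)
  obtain ⟨U₁, ho₁, hx₁, h₁⟩ := eventually_comap_nhds (x := x) (P := fun y => y ∈ W) hW
  obtain ⟨U₂, hs₂, ho₂, hx₂⟩ := exists_sheet E f x s
  obtain ⟨U, ht, ho, hx⟩ := exists_sheet E f (g • x)
    ⟨E.translate g s.1, translate_mem E hf g rfl s.2⟩
  have hcp := push_continuous_fst E f
  refine continuousAt_of_sheet (push_isOpenMap_fst E f) ?_
    (isOpen_sheet E f ho _ ht) (injOn_sheet E f _ ht) ?_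
  · exact (continuous_fst.smul (hcp.comp continuous_snd)).continuousAt
  have c1 : ∀ᶠ q : G × (Σ x, PushStalk E f x) in 𝓝 (g, ⟨x, germ E f x s⟩),
      q.1 • q.2.1 ∈ U :=
    (continuous_fst.smul (hcp.comp continuous_snd)).continuousAt.eventually_mem (ho.mem_nhds hx)
  have c2 : ∀ᶠ q : G × (Σ x, PushStalk E f x) in 𝓝 (g, ⟨x, germ E f x s⟩),
      g⁻¹ * q.1 ∈ N := by
    have hcont : Continuous fun q : G × (Σ x, PushStalk E f x) => g⁻¹ * q.1 :=
      continuous_const.mul continuous_fst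
    exact hcont.continuousAt.eventually_mem (by simpa using hN)
  have c3 : ∀ᶠ q : G × (Σ x, PushStalk E f x) in 𝓝 (g, ⟨x, germ E f x s⟩),
      g⁻¹ • q.1 • q.2.1 ∈ U₁ := by
    have hcont : Continuous fun q : G × (Σ x, PushStalk E f x) => g⁻¹ • q.1 • q.2.1 :=
      continuous_const.smul (continuous_fst.smul (hcp.comp continuous_snd))
    exact hcont.continuousAt.eventually_mem (by simpa using ho₁.mem_nhds hx₁)
  have c4 : ∀ᶠ q : G × (Σ x, PushStalk E f x) in 𝓝 (g, ⟨x, germ E f x s⟩),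
      q.2 ∈ sheet E f U₂ s.1 hs₂ :=
    continuous_snd.continuousAt.eventually_mem
      ((isOpen_sheet E f ho₂ s.1 hs₂).mem_nhds ⟨⟨x, hx₂⟩, rfl⟩)
  filter_upwards [c1, c2, c3, c4]
  rintro ⟨g', ⟨x', e'⟩⟩ h1 h2 h3 h4
  obtain ⟨s', rfl⟩ := germ_surj E f x' e'
  rw [mem_sheet] at h4
  change (⟨g' • x', pushAct E hf g' x' (g' • x') rfl (germ E f x' s')⟩ : Σ x, PushStalk E f x) ∈ _
  rw [pushAct_germ, mem_sheet]
  refine ⟨h1, ?_⟩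
  have h5 : ∀ᶠ y in comap f (𝓝 (g' • x')), s'.1 (g'⁻¹ • y) = s.1 (g'⁻¹ • y) :=
    (tendsto_translate hf g' rfl).eventually h4.2
  have h6 : ∀ᶠ y in comap f (𝓝 (g' • x')), g⁻¹ • y ∈ W :=
    (tendsto_translate hf g (smul_inv_smul g (g' • x'))).eventually (h₁ _ h3)
  filter_upwards [h5, h6] with y h7 h8
  have h9 : E.translate (g⁻¹ * g') s.1 (g⁻¹ • y) = s.1 (g⁻¹ • y) :=
    hNW (Set.mk_mem_prod h2 h8)
  calc E.translate g' s'.1 y = E.translate g' s.1 y := by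
        rw [E.translate_apply g' s'.1 (x := g'⁻¹ • y) (by simp), h7]
        rfl
    _ = E.translate g (E.translate (g⁻¹ * g') s.1) y := by
        rw [← E.translate_mul, mul_inv_cancel_left]
    _ = E.translate g s.1 y := by
        rw [E.translate_apply g (E.translate (g⁻¹ * g') s.1) (x := g⁻¹ • y) (by simp), h9]
        rfl

/-- The push forward `f_* E` of a `G`-sheaf along an equivariant map `f : Y → X` from a compact
space to a Hausdorff space: the sheaf space of the presheaf `U ↦ Γ(f ⁻¹ U, E)`. -/
def pushForwardObj [CompactSpace Y] [T2Space X] {f : Y → X}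
    (hf : ∀ (g : G) y, f (g • y) = g • f y) (hc : Continuous f) (E : GSheaf R G Y) :
    GSheaf R G X where
  stalk := PushStalk E f
  isLocalHomeomorph := push_isLocalHomeomorph E f
  continuous_sub := push_continuous_sub E f
  continuous_smul := push_continuous_smul E f
  act := pushAct E hf
  act_one x h e := by
    obtain ⟨s, rfl⟩ := germ_surj E f x e
    rw [pushAct_germ]
    congr 1
    exact Subtype.ext (E.translate_one s.1)
  act_mul g k x y z hk hg hgk e := by
    obtain ⟨s, rfl⟩ := germ_surj E f x e
    rw [pushAct_germ, pushAct_germ, pushAct_germ]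
    congr 1
    exact Subtype.ext (E.translate_mul g k s.1)
  continuous_act := push_continuous_act E hf hc

/-- Composition of sections with a map of `G`-sheaves. -/
def mapSections {E F : GSheaf R G Y} (φ : E ⟶ F) : (∀ y, E.stalk y) →ₗ[R] (∀ y, F.stalk y) where
  toFun s := fun y => φ.app y (s y)
  map_add' s t := by ext y; simp
  map_smul' r s := by ext y; simp

theorem mapSections_mem {E F : GSheaf R G Y} (φ : E ⟶ F) (f : Y → X) (x : X)
    {s : ∀ y, E.stalk y} (hs : s ∈ sectionsNear E f x) :
    mapSections φ s ∈ sectionsNear F f x :=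
  have hs' : ∀ᶠ y in comap f (𝓝 x), ContinuousAt (fun y => (⟨y, s y⟩ : E.Total)) y := hs
  hs'.mono fun _ h => φ.continuous_app.continuousAt.comp h

theorem mapSections_mem_zero {E F : GSheaf R G Y} (φ : E ⟶ F) (f : Y → X) (x : X)
    {s : ∀ y, E.stalk y} (hs : s ∈ zeroNear E f x) :
    mapSections φ s ∈ zeroNear F f x :=
  have hs' : ∀ᶠ y in comap f (𝓝 x), s y = 0 := hs
  hs'.mono fun y h => by
    change φ.app y (s y) = 0
    rw [h, map_zero]

/-- The map on germs induced by a map of `G`-sheaves. -/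
def pushApp {E F : GSheaf R G Y} (φ : E ⟶ F) (f : Y → X) (x : X) :
    PushStalk E f x →ₗ[R] PushStalk F f x :=
  Submodule.mapQ _ _
    ((mapSections φ).restrict fun _ hs => mapSections_mem φ f x hs)
    fun _ hs => mapSections_mem_zero φ f x hs

theorem pushApp_germ {E F : GSheaf R G Y} (φ : E ⟶ F) (f : Y → X) (x : X)
    (s : sectionsNear E f x) : pushApp φ f x (germ E f x s) =
      germ F f x ⟨mapSections φ s.1, mapSections_mem φ f x s.2⟩ :=
  rfl

theorem pushApp_continuous {E F : GSheaf R G Y} (φ : E ⟶ F) (f : Y → X) :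
    Continuous fun e : Σ x, PushStalk E f x =>
      (⟨e.1, pushApp φ f e.1 e.2⟩ : Σ x, PushStalk F f x) := by
  rw [continuous_iff_continuousAt]
  rintro ⟨x, e⟩
  obtain ⟨s, rfl⟩ := germ_surj E f x e
  obtain ⟨U, hs, ho, hx⟩ := exists_sheet E f x s
  have hst : ∀ x ∈ U, mapSections φ s.1 ∈ sectionsNear F f x :=
    fun x hx => mapSections_mem φ f x (hs x hx)
  refine continuousAt_of_sheet (push_isOpenMap_fst F f) (push_continuous_fst E f).continuousAt
    (isOpen_sheet F f ho _ hst) (injOn_sheet F f _ hst) ?_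
  filter_upwards [(isOpen_sheet E f ho s.1 hs).mem_nhds ⟨⟨x, hx⟩, rfl⟩]
  rintro ⟨x', e⟩ h₁
  obtain ⟨s', rfl⟩ := germ_surj E f x' e
  rw [mem_sheet] at h₁
  refine (mem_sheet F f _ hst x' ⟨mapSections φ s'.1, mapSections_mem φ f x' s'.2⟩).2 ⟨h₁.1, ?_⟩
  filter_upwards [h₁.2] with y h₃
  change φ.app y (s'.1 y) = φ.app y (s.1 y)
  rw [h₃]

/-- The push forward functor `f_*`. -/
def pushForward [CompactSpace Y] [T2Space X] {f : Y → X}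
    (hf : ∀ (g : G) y, f (g • y) = g • f y) (hc : Continuous f) :
    GSheaf R G Y ⥤ GSheaf R G X where
  obj E := pushForwardObj hf hc E
  map {E F} φ :=
    { app := pushApp φ f
      continuous_app := pushApp_continuous φ f
      app_act := fun g x x' h e => by
        obtain ⟨s, rfl⟩ := germ_surj E f x e
        change pushApp φ f x' (pushAct E hf g x x' h (germ E f x s)) =
          pushAct F hf g x x' h (pushApp φ f x (germ E f x s))
        rw [pushAct_germ, pushApp_germ, pushApp_germ, pushAct_germ]
        congr 1
        exact Subtype.ext (funext fun y => φ.app_act _ _ _ _ _) }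
  map_id E := by
    ext x e
    obtain ⟨s, rfl⟩ := germ_surj E f x e
    rfl
  map_comp φ ψ := by
    ext x e
    obtain ⟨s, rfl⟩ := germ_surj _ f x e
    rfl

end PushForward

section DiscreteModules

variable {R H : Type u} [Ring R] [Group H]

/-- The action of an element `h` on an `R[H]`-module, that is, an `R`-module with an action of `H`
by `R`-linear maps. -/
def smulMap (M : Action (ModuleCat.{u} R) H) (h : H) : M.V →ₗ[R] M.V := ModuleCat.Hom.hom (M.ρ h)

@[simp]
theorem smulMap_one (M : Action (ModuleCat.{u} R) H) (m : M.V) : smulMap M 1 m = m := by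
  simp [smulMap]

theorem smulMap_mul (M : Action (ModuleCat.{u} R) H) (h k : H) (m : M.V) :
    smulMap M (h * k) m = smulMap M h (smulMap M k m) := by
  simp [smulMap]

variable (R H) [TopologicalSpace H]

/-- An `R[H]`-module `M` is discrete if the action `H × M → M` is continuous for the discrete
topology on `M`. -/
def isDiscrete : ObjectProperty (Action (ModuleCat.{u} R) H) := fun M =>
  Continuous[@instTopologicalSpaceProd H M.V _ ⊥, ⊥] fun q : H × M.V => smulMap M q.1 q.2

/-- The category of discrete `R[H]`-modules. -/
abbrev DiscreteModule : Type (u + 1) := (isDiscrete R H).FullSubcategory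

end DiscreteModules

section Stalks

variable (R G : Type u) {X : Type u} [Ring R] [Group G] [TopologicalSpace G] [TopologicalSpace X]
  [MulAction G X]

variable {R G} in
/-- The `R[Stab(x)]`-module `E_x`. -/
def stalkRep (E : GSheaf R G X) (x : X) :
    Action (ModuleCat.{u} R) (MulAction.stabilizer G x) where
  V := ModuleCat.of R (E.stalk x)
  ρ :=
    { toFun := fun h => ModuleCat.ofHom (E.act h.1 x x (MulAction.mem_stabilizer_iff.1 h.2))
      map_one' := ModuleCat.hom_ext (LinearMap.ext fun e => E.act_one x _ e)
      map_mul' := fun h k => ModuleCat.hom_ext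
        (LinearMap.ext fun e => E.act_mul h.1 k.1 x x x _ _ _ e) }

theorem stalkRep_isDiscrete (E : GSheaf R G X) (x : X) :
    isDiscrete R (MulAction.stabilizer G x) (stalkRep E x) := by
  let _ : TopologicalSpace (E.stalk x) := ⊥
  have : DiscreteTopology (E.stalk x) := ⟨rfl⟩
  change Continuous fun q : MulAction.stabilizer G x × E.stalk x => E.act q.1.1 x x (MulAction.mem_stabilizer_iff.1 q.1.2) q.2
  have hc : Continuous fun q : MulAction.stabilizer G x × E.stalk x =>
      (⟨x, E.act q.1.1 x x (MulAction.mem_stabilizer_iff.1 q.1.2) q.2⟩ : E.Total) := by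
    have h1 : (fun q : MulAction.stabilizer G x × E.stalk x =>
        (⟨x, E.act q.1.1 x x (MulAction.mem_stabilizer_iff.1 q.1.2) q.2⟩ : E.Total)) =
        fun q => ⟨q.1.1 • x, E.act q.1.1 x _ rfl q.2⟩ := by
      ext1 q
      exact E.act_total _ _ _ _ _
    rw [h1]
    have h2 : Continuous fun q : MulAction.stabilizer G x × E.stalk x =>
        ((q.1.1, ⟨x, q.2⟩) : G × E.Total) :=
      (continuous_subtype_val.comp continuous_fst).prodMk
        ((continuous_of_discreteTopology (f := fun e : E.stalk x => (⟨x, e⟩ : E.Total))).comp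
          continuous_snd)
    exact E.continuous_act.comp h2
  rw [continuous_iff_continuousAt]
  intro q
  have h3 := eventually_eq_of_proj E.isLocalHomeomorph hc.continuousAt
    (continuousAt_const (y := (⟨x, E.act q.1.1 x x (MulAction.mem_stabilizer_iff.1 q.1.2) q.2⟩ : E.Total))) (fun _ => rfl) rfl
  rw [ContinuousAt, nhds_discrete (E.stalk x), tendsto_pure]
  filter_upwards [h3] with q' hq
  exact eq_of_heq (Sigma.mk.inj hq).2

/-- The functor `E ↦ E_x` from `G`-sheaves of `R`-modules to discrete `R[Stab(x)]`-modules. -/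
def stalkFunctor (x : X) : GSheaf R G X ⥤ DiscreteModule R (MulAction.stabilizer G x) where
  obj E := ⟨stalkRep E x, stalkRep_isDiscrete R G E x⟩
  map {E F} φ := ObjectProperty.homMk
    { hom := ModuleCat.ofHom (φ.app x)
      comm := fun h => ModuleCat.hom_ext
        (LinearMap.ext fun e => φ.app_act h.1 x x _ e) }

end Stalks

section Induced

variable {R G X : Type u} [Ring R] [Group G] [TopologicalSpace G] [TopologicalSpace X]
  [MulAction G X] {x : X}

/-- The elements `g` with `g • x = y`. -/
abbrev Lifts (G : Type u) {X : Type u} [Group G] [MulAction G X] (x : X)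
    (y : MulAction.orbit G x) : Type u := {g : G // g • x = y.1}

/-- The fibre over `y = g x` of `G ×_{Stab(x)} M`: pairs `(g, m)` with `g x = y`, up to
`(g h, m) ∼ (g, h m)` for `h` in `Stab(x)`. -/
def indSetoid (M : Action (ModuleCat.{u} R) (MulAction.stabilizer G x))
    (y : MulAction.orbit G x) : Setoid (Lifts G x y × M.V) where
  r a b := ∃ h : MulAction.stabilizer G x, a.1.1 = b.1.1 * h ∧ b.2 = smulMap M h a.2
  iseqv :=
    { refl := fun a => ⟨1, by simp⟩
      symm := by
        rintro a b ⟨h, h1, h2⟩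
        refine ⟨h⁻¹, by simp [h1], ?_⟩
        rw [h2, ← smulMap_mul, inv_mul_cancel, smulMap_one]
      trans := by
        rintro a b c ⟨h, h1, h2⟩ ⟨k, h3, h4⟩
        refine ⟨k * h, by simp [h1, h3, mul_assoc], ?_⟩
        rw [h4, h2, smulMap_mul] }

/-- The fibre of `G ×_{Stab(x)} M → G x` over `y`. -/
def IndStalk (M : Action (ModuleCat.{u} R) (MulAction.stabilizer G x))
    (y : MulAction.orbit G x) : Type u := Quotient (indSetoid M y)

variable (M : Action (ModuleCat.{u} R) (MulAction.stabilizer G x))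

/-- The class `[g, m]`. -/
def indMk {y : MulAction.orbit G x} (g : Lifts G x y) (m : M.V) : IndStalk M y :=
  Quotient.mk (indSetoid M y) (g, m)

/-- The element `g'⁻¹ g` of `Stab(x)` for `g x = g' x`. -/
def liftDiff {y : MulAction.orbit G x} (g' g : Lifts G x y) : MulAction.stabilizer G x :=
  ⟨g'.1⁻¹ * g.1, by
    rw [MulAction.mem_stabilizer_iff, mul_smul, g.2, inv_smul_eq_iff, g'.2]⟩

theorem indMk_eq_iff {y : MulAction.orbit G x} (g g' : Lifts G x y) (m m' : M.V) :
    indMk M g m = indMk M g' m' ↔ m' = smulMap M (liftDiff g' g) m := by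
  refine (Quotient.eq (r := indSetoid M y)).trans ?_
  constructor
  · rintro ⟨h, h1, h2⟩
    have : liftDiff g' g = h := Subtype.ext (by
      change g'.1⁻¹ * g.1 = h
      rw [show g.1 = g'.1 * h from h1, inv_mul_cancel_left])
    rw [this]
    exact h2
  · intro h
    exact ⟨liftDiff g' g, by simp [liftDiff], h⟩

theorem indMk_surj {y : MulAction.orbit G x} (g : Lifts G x y) (e : IndStalk M y) :
    ∃ m, indMk M g m = e := by
  induction e using Quotient.inductionOn with
  | h a => exact ⟨smulMap M (liftDiff g a.1) a.2, ((indMk_eq_iff M a.1 g a.2 _).2 rfl).symm⟩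

/-- For each `g` with `g x = y`, the bijection `m ↦ [g, m]` from `M` to the fibre over `y`. -/
noncomputable def indEquiv {y : MulAction.orbit G x} (g : Lifts G x y) : M.V ≃ IndStalk M y :=
  Equiv.ofBijective (indMk M g) ⟨fun m m' h => by
    rw [indMk_eq_iff] at h
    have : liftDiff g g = 1 := Subtype.ext (inv_mul_cancel g.1)
    rw [this, smulMap_one] at h
    exact h.symm, indMk_surj M g⟩

instance (y : MulAction.orbit G x) : Nonempty (Lifts G x y) := by
  obtain ⟨_, g, rfl⟩ := y
  exact ⟨⟨g, rfl⟩⟩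

/-- The module structure on the fibre over `y` for which all the bijections `m ↦ [g, m]` are
`R`-linear, see `indMk_add` and `indMk_smul`. -/
noncomputable instance (y : MulAction.orbit G x) : AddCommGroup (IndStalk M y) :=
  (indEquiv M (Classical.arbitrary (Lifts G x y))).symm.addCommGroup

noncomputable instance (y : MulAction.orbit G x) : Module R (IndStalk M y) :=
  (indEquiv M (Classical.arbitrary (Lifts G x y))).symm.module R

theorem indMk_change {y : MulAction.orbit G x} (g g' : Lifts G x y) (m : M.V) :
    indMk M g m = indMk M g' (smulMap M (liftDiff g' g) m) :=
  (indMk_eq_iff M g g' m _).2 rfl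

theorem indMk_add {y : MulAction.orbit G x} (g : Lifts G x y) (m m' : M.V) :
    indMk M g (m + m') = indMk M g m + indMk M g m' := by
  have key : ∀ m m', indMk M (Classical.arbitrary (Lifts G x y)) (m + m') =
      indMk M (Classical.arbitrary (Lifts G x y)) m +
      indMk M (Classical.arbitrary (Lifts G x y)) m' := fun m m' =>
    ((indEquiv M (Classical.arbitrary (Lifts G x y))).symm.addEquiv.symm).map_add m m'
  rw [indMk_change M g (Classical.arbitrary (Lifts G x y)), map_add, key, ← indMk_change,
    ← indMk_change]

theorem indMk_smul {y : MulAction.orbit G x} (g : Lifts G x y) (r : R) (m : M.V) :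
    indMk M g (r • m) = r • indMk M g m := by
  have key : ∀ m, indMk M (Classical.arbitrary (Lifts G x y)) (r • m) =
      r • indMk M (Classical.arbitrary (Lifts G x y)) m := fun m =>
    ((indEquiv M (Classical.arbitrary (Lifts G x y))).symm.linearEquiv R).symm.map_smul r m
  rw [indMk_change M g (Classical.arbitrary (Lifts G x y)), map_smul, key, ← indMk_change]

theorem indMk_sub {y : MulAction.orbit G x} (g : Lifts G x y) (m m' : M.V) :
    indMk M g (m - m') = indMk M g m - indMk M g m' := by
  rw [eq_sub_iff_add_eq, ← indMk_add, sub_add_cancel]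

/-- The quotient map `G × M → G ×_{Stab(x)} M`, `(g, m) ↦ [g, m]`. -/
def indQuot (q : G × M.V) : Σ y, IndStalk M y :=
  ⟨⟨q.1 • x, q.1, rfl⟩, indMk M ⟨q.1, rfl⟩ q.2⟩

/-- The quotient topology on `G ×_{Stab(x)} M`, where `M` has the discrete topology. -/
instance indTop : TopologicalSpace (Σ y, IndStalk M y) :=
  TopologicalSpace.coinduced (indQuot M) (@instTopologicalSpaceProd G M.V _ ⊥)

theorem indQuot_eq {y : MulAction.orbit G x} (g : Lifts G x y) (m : M.V) :
    indQuot M (g.1, m) = ⟨y, indMk M g m⟩ := by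
  obtain ⟨g, hg⟩ := g
  obtain ⟨y, hy⟩ := y
  obtain rfl : g • x = y := hg
  rfl

theorem indQuot_eq_iff (q q' : G × M.V) :
    indQuot M q = indQuot M q' ↔
      ∃ h : MulAction.stabilizer G x, q.1 = q'.1 * h ∧ q'.2 = smulMap M h q.2 := by
  constructor
  · intro h
    have h1 : q.1 • x = q'.1 • x := congrArg (fun e => e.1.1) h
    have h2 := indQuot_eq M (⟨q.1, h1⟩ : Lifts G x ⟨q'.1 • x, q'.1, rfl⟩) q.2
    change indQuot M q = _ at h2
    rw [h2] at h
    have h3 := eq_of_heq (Sigma.mk.inj h).2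
    rw [indMk_eq_iff] at h3
    exact ⟨_, (mul_inv_cancel_left q'.1 q.1).symm, h3⟩
  · rintro ⟨h, h1, h2⟩
    have h3 : q.1 • x = q'.1 • x := by rw [h1, mul_smul, h.2]
    have h4 := indQuot_eq M (⟨q.1, h3⟩ : Lifts G x ⟨q'.1 • x, q'.1, rfl⟩) q.2
    change indQuot M q = _ at h4
    rw [h4]
    change _ = (⟨_, indMk M ⟨q'.1, rfl⟩ q'.2⟩ : Σ y, IndStalk M y)
    congr 1
    exact Quotient.sound ⟨h, h1, h2⟩

theorem indQuot_surj : Function.Surjective (indQuot M) := by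
  rintro ⟨y, e⟩
  obtain ⟨m, rfl⟩ := indMk_surj M (Classical.arbitrary (Lifts G x y)) e
  exact ⟨_, indQuot_eq M _ m⟩

theorem indQuot_isOpenQuotientMap [IsTopologicalGroup G] :
    @IsOpenQuotientMap _ _ (@instTopologicalSpaceProd G M.V _ ⊥) _ (indQuot M) := by
  let _ : TopologicalSpace M.V := ⊥
  have : DiscreteTopology M.V := ⟨rfl⟩
  refine ⟨indQuot_surj M, continuous_coinduced_rng, ?_⟩
  intro V hV
  rw [isOpen_coinduced]
  have : indQuot M ⁻¹' (indQuot M '' V) = ⋃ h : MulAction.stabilizer G x,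
      (fun q : G × M.V => (q.1 * (h : G), smulMap M h⁻¹ q.2)) ⁻¹' V := by
    ext q
    simp only [Set.mem_preimage, Set.mem_image, Set.mem_iUnion]
    constructor
    · rintro ⟨q', hq', h⟩
      obtain ⟨k, h1, h2⟩ := (indQuot_eq_iff M _ _).1 h
      refine ⟨k, ?_⟩
      have h3 : (q.1 * (k : G), smulMap M k⁻¹ q.2) = q' := by
        ext1
        · exact h1.symm
        · change smulMap M k⁻¹ q.2 = q'.2
          rw [h2, ← smulMap_mul, inv_mul_cancel, smulMap_one]
      rwa [h3]
    · rintro ⟨k, hk⟩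
      refine ⟨_, hk, (indQuot_eq_iff M _ _).2 ⟨k, rfl, ?_⟩⟩
      change q.2 = smulMap M k (smulMap M k⁻¹ q.2)
      rw [← smulMap_mul, mul_inv_cancel, smulMap_one]
  rw [this]
  refine isOpen_iUnion fun h => hV.preimage ?_
  exact (continuous_fst.mul continuous_const).prodMk
    (continuous_of_discreteTopology.comp continuous_snd)

theorem exists_good [IsTopologicalGroup G] (hM : isDiscrete R _ M) (m : M.V) :
    ∃ V ∈ 𝓝 (1 : G), ∀ h : MulAction.stabilizer G x,
      (∃ a ∈ V, ∃ b ∈ V, (h : G) = a⁻¹ * b) → smulMap M h m = m := by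
  let _ : TopologicalSpace M.V := ⊥
  have : DiscreteTopology M.V := ⟨rfl⟩
  have hM' : Continuous fun q : MulAction.stabilizer G x × M.V => smulMap M q.1 q.2 := hM
  have h1 : Continuous fun h : MulAction.stabilizer G x => smulMap M h m :=
    hM'.comp (continuous_id.prodMk continuous_const)
  have h2 : {h : MulAction.stabilizer G x | smulMap M h m = m} ∈ 𝓝 1 :=
    ((isOpen_discrete {m}).preimage h1).mem_nhds (smulMap_one M m)
  rw [nhds_subtype, mem_comap] at h2
  obtain ⟨W, hW, hsub⟩ := h2
  have h3 : Tendsto (fun q : G × G => q.1⁻¹ * q.2) (𝓝 1 ×ˢ 𝓝 1) (𝓝 1) := by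
    rw [← nhds_prod_eq]
    have : Continuous fun q : G × G => q.1⁻¹ * q.2 := continuous_fst.inv.mul continuous_snd
    simpa using this.tendsto (1, 1)
  obtain ⟨A, hA, B, hB, hAB⟩ := mem_prod_iff.1 (h3 hW)
  refine ⟨A ∩ B, inter_mem hA hB, ?_⟩
  rintro h ⟨a, ha, b, hb, hab⟩
  apply hsub
  change (h : G) ∈ W
  rw [hab]
  exact hAB (Set.mk_mem_prod ha.1 hb.2)

/-- The set of the `[g n, m]` for `n ∈ V`. -/
def indSheet (g : G) (V : Set G) (m : M.V) : Set (Σ y, IndStalk M y) :=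
  indQuot M '' {q | g⁻¹ * q.1 ∈ V ∧ q.2 = m}

theorem isOpen_indSheet [IsTopologicalGroup G] (g : G) {V : Set G} (hV : IsOpen V) (m : M.V) :
    IsOpen (indSheet M g V m) := by
  let _ : TopologicalSpace M.V := ⊥
  have : DiscreteTopology M.V := ⟨rfl⟩
  refine (indQuot_isOpenQuotientMap M).isOpenMap _ ?_
  have h1 : IsOpen ((fun q : G × M.V => g⁻¹ * q.1) ⁻¹' V) :=
    hV.preimage (continuous_const.mul continuous_fst)
  have h2 : IsOpen ((fun q : G × M.V => q.2) ⁻¹' {m}) :=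
    (isOpen_discrete {m}).preimage continuous_snd
  exact h1.inter h2

theorem injOn_indSheet (g : G) {V : Set G} {m : M.V}
    (hV : ∀ h : MulAction.stabilizer G x,
      (∃ a ∈ V, ∃ b ∈ V, (h : G) = a⁻¹ * b) → smulMap M h m = m) :
    Set.InjOn (Sigma.fst : (Σ y, IndStalk M y) → MulAction.orbit G x) (indSheet M g V m) := by
  rintro _ ⟨⟨a, _⟩, ⟨ha, rfl⟩, rfl⟩ _ ⟨⟨b, m⟩, ⟨hb, rfl⟩, rfl⟩ h
  have h1 : a • x = b • x := congrArg Subtype.val h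
  have h2 : b⁻¹ * a ∈ MulAction.stabilizer G x := by
    rw [MulAction.mem_stabilizer_iff, mul_smul, h1, inv_smul_smul]
  refine (indQuot_eq_iff M _ _).2 ⟨⟨_, h2⟩, (mul_inv_cancel_left b a).symm, ?_⟩
  refine (hV ⟨_, h2⟩ ⟨_, hb, _, ha, ?_⟩).symm
  change b⁻¹ * a = (g⁻¹ * b)⁻¹ * (g⁻¹ * a)
  group

variable [IsTopologicalGroup G] [ContinuousSMul G X]

instance : ContinuousSMul G (MulAction.orbit G x) where
  continuous_smul := by
    rw [continuous_induced_rng]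
    exact continuous_fst.smul (continuous_subtype_val.comp continuous_snd)

theorem ind_continuous_fst :
    Continuous (Sigma.fst : (Σ y, IndStalk M y) → MulAction.orbit G x) := by
  let _ : TopologicalSpace M.V := ⊥
  rw [continuous_coinduced_dom, continuous_induced_rng]
  exact continuous_fst.smul continuous_const

instance [CompactSpace G] : CompactSpace (MulAction.orbit G x) := by
  rw [← isCompact_iff_compactSpace]
  exact isCompact_range (continuous_id.smul continuous_const)

theorem ind_isOpenMap_fst [CompactSpace G] [T2Space X] :
    IsOpenMap (Sigma.fst : (Σ y, IndStalk M y) → MulAction.orbit G x) := by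
  let _ : TopologicalSpace M.V := ⊥
  have h1 : IsOpenMap fun g : G => g • (⟨x, MulAction.mem_orbit_self x⟩ : MulAction.orbit G x) :=
    isOpenMap_smul_of_sigmaCompact _
  intro V hV
  have h2 : Sigma.fst '' V =
      (fun g : G => g • (⟨x, MulAction.mem_orbit_self x⟩ : MulAction.orbit G x)) ''
        (Prod.fst '' (indQuot M ⁻¹' V)) := by
    rw [← Set.image_preimage_eq V (indQuot_surj M), Set.preimage_image_preimage,
      Set.image_image, Set.image_image]
    rfl
  rw [h2]
  exact h1 _ (isOpenMap_fst _ (hV.preimage (indQuot_isOpenQuotientMap M).continuous))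

theorem ind_isLocalHomeomorph [CompactSpace G] [T2Space X] (hM : isDiscrete R _ M) :
    IsLocalHomeomorph (Sigma.fst : (Σ y, IndStalk M y) → MulAction.orbit G x) := by
  refine isLocalHomeomorph_of_sheets (ind_continuous_fst M) (ind_isOpenMap_fst M) ?_
  intro e
  obtain ⟨⟨g, m⟩, rfl⟩ := indQuot_surj M e
  obtain ⟨V, hV, hgood⟩ := exists_good M hM m
  refine ⟨indSheet M g (interior V) m, isOpen_indSheet M g isOpen_interior m,
    ⟨(g, m), ⟨?_, rfl⟩, rfl⟩, injOn_indSheet M g ?_⟩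
  · rw [inv_mul_cancel]
    exact mem_interior_iff_mem_nhds.2 hV
  · rintro h ⟨a, ha, b, hb, hab⟩
    exact hgood h ⟨a, interior_subset ha, b, interior_subset hb, hab⟩

theorem ind_continuous_sub [CompactSpace G] [T2Space X] (hM : isDiscrete R _ M) :
    Continuous[fibreSquareTop (IndStalk M) (indTop M), indTop M]
      fun q => ⟨q.1, q.2.1 - q.2.2⟩ := by
  let _ := fibreSquareTop (IndStalk M) (indTop M)
  rw [continuous_iff_continuousAt]
  rintro ⟨y, e₁, e₂⟩
  let g := Classical.arbitrary (Lifts G x y)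
  obtain ⟨m, rfl⟩ := indMk_surj M g e₁
  obtain ⟨m', rfl⟩ := indMk_surj M g e₂
  obtain ⟨V₁, hV₁, hg₁⟩ := exists_good M hM m
  obtain ⟨V₂, hV₂, hg₂⟩ := exists_good M hM m'
  let V := interior (V₁ ∩ V₂)
  have hVo : IsOpen V := isOpen_interior
  have hV1 : (1 : G) ∈ V := mem_interior_iff_mem_nhds.2 (inter_mem hV₁ hV₂)
  have hVs : V ⊆ V₁ ∩ V₂ := interior_subset
  have hg : ∀ h : MulAction.stabilizer G x, (∃ a ∈ V, ∃ b ∈ V, (h : G) = a⁻¹ * b) →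
      smulMap M h m = m ∧ smulMap M h m' = m' := by
    rintro h ⟨a, ha, b, hb, hab⟩
    exact ⟨hg₁ h ⟨a, (hVs ha).1, b, (hVs hb).1, hab⟩, hg₂ h ⟨a, (hVs ha).2, b, (hVs hb).2, hab⟩⟩
  have hi : Continuous (fun q : Σ y, IndStalk M y × IndStalk M y =>
      ((⟨q.1, q.2.1⟩, ⟨q.1, q.2.2⟩) : (Σ y, IndStalk M y) × (Σ y, IndStalk M y))) :=
    continuous_induced_dom
  refine continuousAt_of_sheet (ind_isOpenMap_fst M) ?_
    (isOpen_indSheet M g.1 hVo (m - m')) (injOn_indSheet M g.1 ?_) ?_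
  · exact ((ind_continuous_fst M).comp (continuous_fst.comp hi)).continuousAt
  · intro h hh
    rw [map_sub, (hg h hh).1, (hg h hh).2]
  · have hmem : ∀ m, (⟨y, indMk M g m⟩ : Σ y, IndStalk M y) ∈ indSheet M g.1 V m := fun m =>
      ⟨(g.1, m), ⟨by rwa [inv_mul_cancel], rfl⟩, indQuot_eq M g m⟩
    have hW := ((isOpen_indSheet M g.1 hVo m).prod (isOpen_indSheet M g.1 hVo m')).preimage hi
    filter_upwards [hW.mem_nhds ⟨hmem m, hmem m'⟩]
    rintro ⟨y', e₁, e₂⟩ ⟨⟨⟨a, m₁⟩, ⟨ha, h1⟩, h2⟩, ⟨⟨b, m₂⟩, ⟨hb, h3⟩, h4⟩⟩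
    obtain rfl : m₁ = m := h1
    obtain rfl : m₂ = m' := h3
    have ha' : a • x = y'.1 := congrArg (fun e => e.1.1) h2
    have hb' : b • x = y'.1 := congrArg (fun e => e.1.1) h4
    have h5 : e₁ = indMk M ⟨a, ha'⟩ m₁ := by
      have := h2.symm.trans (indQuot_eq M ⟨a, ha'⟩ m₁)
      exact eq_of_heq (Sigma.mk.inj this).2
    have h6 : e₂ = indMk M ⟨b, hb'⟩ m₂ := by
      have := h4.symm.trans (indQuot_eq M ⟨b, hb'⟩ m₂)
      exact eq_of_heq (Sigma.mk.inj this).2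
    have h7 : indMk M ⟨b, hb'⟩ m₂ = indMk M ⟨a, ha'⟩ m₂ := by
      rw [indMk_eq_iff]
      refine ((hg _ ⟨_, ha, _, hb, ?_⟩).2).symm
      change a⁻¹ * b = (g.1⁻¹ * a)⁻¹ * (g.1⁻¹ * b)
      group
    refine ⟨(a, m₁ - m₂), ⟨ha, rfl⟩, ?_⟩
    rw [h5, h6, h7, ← indMk_sub]
    exact indQuot_eq M ⟨a, ha'⟩ _

theorem ind_continuous_smul (r : R) :
    Continuous fun e : Σ y, IndStalk M y => (⟨e.1, r • e.2⟩ : Σ y, IndStalk M y) := by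
  let _ : TopologicalSpace M.V := ⊥
  have : DiscreteTopology M.V := ⟨rfl⟩
  rw [← (indQuot_isOpenQuotientMap M).continuous_comp_iff]
  have h1 : (fun e : Σ y, IndStalk M y => (⟨e.1, r • e.2⟩ : Σ y, IndStalk M y)) ∘ indQuot M =
      indQuot M ∘ fun q => (q.1, r • q.2) := by
    ext1 q
    change _ = (⟨_, indMk M _ (r • q.2)⟩ : Σ y, IndStalk M y)
    rw [indMk_smul]
    rfl
  rw [h1]
  exact (indQuot_isOpenQuotientMap M).continuous.comp
    (continuous_fst.prodMk (continuous_of_discreteTopology.comp continuous_snd))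

/-- The lift `k g` of `k y`, for a lift `g` of `y`. -/
def liftMul (k : G) {y z : MulAction.orbit G x} (h : k • y = z) (g : Lifts G x y) :
    Lifts G x z :=
  ⟨k * g.1, by rw [mul_smul, g.2, ← h]; rfl⟩

/-- The action `k [g, m] = [k g, m]`. -/
def indAct (k : G) (y z : MulAction.orbit G x) (h : k • y = z) :
    IndStalk M y →ₗ[R] IndStalk M z where
  toFun := Quotient.map (fun a => (liftMul k h a.1, a.2)) (by
    rintro a b ⟨t, h1, h2⟩
    refine ⟨t, ?_, h2⟩
    change k * a.1.1 = k * b.1.1 * t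
    rw [h1, mul_assoc])
  map_add' e₁ e₂ := by
    let g := Classical.arbitrary (Lifts G x y)
    obtain ⟨m, rfl⟩ := indMk_surj M g e₁
    obtain ⟨m', rfl⟩ := indMk_surj M g e₂
    rw [← indMk_add]
    exact indMk_add M (liftMul k h g) m m'
  map_smul' r e := by
    let g := Classical.arbitrary (Lifts G x y)
    obtain ⟨m, rfl⟩ := indMk_surj M g e
    rw [← indMk_smul]
    exact indMk_smul M (liftMul k h g) r m

theorem indAct_mk (k : G) (y z : MulAction.orbit G x) (h : k • y = z) (g : Lifts G x y)
    (m : M.V) : indAct M k y z h (indMk M g m) = indMk M (liftMul k h g) m :=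
  rfl

theorem ind_continuous_act :
    Continuous fun q : G × (Σ y, IndStalk M y) =>
      (⟨q.1 • q.2.1, indAct M q.1 q.2.1 (q.1 • q.2.1) rfl q.2.2⟩ : Σ y, IndStalk M y) := by
  let _ : TopologicalSpace M.V := ⊥
  have hq := indQuot_isOpenQuotientMap M
  rw [← (IsOpenQuotientMap.id.prodMap hq).continuous_comp_iff]
  have h1 : ((fun q : G × (Σ y, IndStalk M y) =>
      (⟨q.1 • q.2.1, indAct M q.1 q.2.1 (q.1 • q.2.1) rfl q.2.2⟩ : Σ y, IndStalk M y)) ∘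
      Prod.map id (indQuot M)) = indQuot M ∘ fun q : G × (G × M.V) => (q.1 * q.2.1, q.2.2) := by
    ext1 ⟨k, g, m⟩
    exact (indQuot_eq M (liftMul k rfl (⟨g, rfl⟩ : Lifts G x ⟨g • x, g, rfl⟩)) m).symm
  rw [h1]
  exact hq.continuous.comp ((continuous_fst.mul (continuous_fst.comp continuous_snd)).prodMk
    (continuous_snd.comp continuous_snd))

/-- The `G`-sheaf `G ×_{Stab(x)} M → G x`, `[g, m] ↦ g x`, on the orbit of `x`, for a discrete
`R[Stab(x)]`-module `M`. -/
noncomputable def inducedObj [CompactSpace G] [T2Space X]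
    (M : DiscreteModule R (MulAction.stabilizer G x)) : GSheaf R G (MulAction.orbit G x) where
  stalk := IndStalk M.obj
  isLocalHomeomorph := ind_isLocalHomeomorph M.obj M.property
  continuous_sub := ind_continuous_sub M.obj M.property
  continuous_smul := ind_continuous_smul M.obj
  act := indAct M.obj
  act_one y h e := by
    obtain ⟨m, rfl⟩ := indMk_surj M.obj (Classical.arbitrary (Lifts G x y)) e
    rw [indAct_mk]
    congr 1
    exact Subtype.ext (one_mul _)
  act_mul g k y z w hk hg hgk e := by
    obtain ⟨m, rfl⟩ := indMk_surj M.obj (Classical.arbitrary (Lifts G x y)) e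
    rw [indAct_mk, indAct_mk, indAct_mk]
    congr 1
    exact Subtype.ext (mul_assoc _ _ _)
  continuous_act := ind_continuous_act M.obj

theorem hom_smulMap {M N : Action (ModuleCat.{u} R) (MulAction.stabilizer G x)} (φ : M ⟶ N)
    (h : MulAction.stabilizer G x) (m : M.V) :
    φ.hom.hom (smulMap M h m) = smulMap N h (φ.hom.hom m) :=
  congrArg (fun ψ : M.V ⟶ N.V => ψ.hom m) (φ.comm h)

/-- The map `[g, m] ↦ [g, φ m]`. -/
def indApp {M N : Action (ModuleCat.{u} R) (MulAction.stabilizer G x)} (φ : M ⟶ N)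
    (y : MulAction.orbit G x) : IndStalk M y →ₗ[R] IndStalk N y where
  toFun := Quotient.map (fun a => (a.1, φ.hom.hom a.2)) (by
    rintro a b ⟨t, h1, h2⟩
    refine ⟨t, h1, ?_⟩
    change φ.hom.hom b.2 = _
    rw [h2]
    exact hom_smulMap φ t a.2)
  map_add' e₁ e₂ := by
    let g := Classical.arbitrary (Lifts G x y)
    obtain ⟨m, rfl⟩ := indMk_surj M g e₁
    obtain ⟨m', rfl⟩ := indMk_surj M g e₂
    rw [← indMk_add]
    change indMk N g (φ.hom.hom (m + m')) = indMk N g (φ.hom.hom m) + indMk N g (φ.hom.hom m')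
    rw [map_add, indMk_add]
  map_smul' r e := by
    let g := Classical.arbitrary (Lifts G x y)
    obtain ⟨m, rfl⟩ := indMk_surj M g e
    rw [← indMk_smul]
    change indMk N g (φ.hom.hom (r • m)) = r • indMk N g (φ.hom.hom m)
    rw [map_smul, indMk_smul]

theorem indApp_mk {M N : Action (ModuleCat.{u} R) (MulAction.stabilizer G x)} (φ : M ⟶ N)
    (y : MulAction.orbit G x) (g : Lifts G x y) (m : M.V) :
    indApp φ y (indMk M g m) = indMk N g (φ.hom.hom m) :=
  rfl

theorem indApp_continuous {M N : Action (ModuleCat.{u} R) (MulAction.stabilizer G x)}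
    (φ : M ⟶ N) : Continuous fun e : Σ y, IndStalk M y =>
      (⟨e.1, indApp φ e.1 e.2⟩ : Σ y, IndStalk N y) := by
  let _ : TopologicalSpace M.V := ⊥
  let _ : TopologicalSpace N.V := ⊥
  have : DiscreteTopology M.V := ⟨rfl⟩
  rw [← (indQuot_isOpenQuotientMap M).continuous_comp_iff]
  exact (indQuot_isOpenQuotientMap N).continuous.comp
    (continuous_fst.prodMk ((continuous_of_discreteTopology (f := φ.hom.hom)).comp continuous_snd))

variable (R G) in
/-- The functor `G ×_{Stab(x)} (-)` from discrete `R[Stab(x)]`-modules to `G`-sheaves of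
`R`-modules over the orbit of `x`. -/
noncomputable def induced [CompactSpace G] [T2Space X] (x : X) :
    DiscreteModule R (MulAction.stabilizer G x) ⥤ GSheaf R G (MulAction.orbit G x) where
  obj M := inducedObj M
  map {M N} φ :=
    { app := indApp φ.hom
      continuous_app := indApp_continuous φ.hom
      app_act := fun k y z h e => by
        obtain ⟨m, rfl⟩ := indMk_surj M.obj (Classical.arbitrary (Lifts G x y)) e
        rfl }
  map_id M := by
    ext y e
    obtain ⟨m, rfl⟩ := indMk_surj M.obj (Classical.arbitrary (Lifts G x y)) e
    rfl
  map_comp {M _ _} φ ψ := by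
    ext y e
    obtain ⟨m, rfl⟩ := indMk_surj M.obj (Classical.arbitrary (Lifts G x y)) e
    rfl

variable (R G) in
/-- The equivariant skyscraper functor `i_* (G ×_{Stab(x)} (-))`, where `i` is the inclusion of the
orbit of `x` in `X`. -/
noncomputable def skyscraper [CompactSpace G] [T2Space X] (x : X) :
    DiscreteModule R (MulAction.stabilizer G x) ⥤ GSheaf R G X :=
  induced R G x ⋙ pushForward (f := (Subtype.val : MulAction.orbit G x → X))
    (fun _ _ => rfl) continuous_subtype_val

end Induced

end EquivSheaf

/-!
The stalk functor at `x` is left adjoint to the equivariant skyscraper functor because a map from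
`K` to a push forward `f_* E` is the same as an `f`-cohomomorphism: a family of maps
`K_{f y} → E_y`, compatible with sections and with the action (`Cohomomorphism.toPush`,
`Cohomomorphism.eq_toPush`). For the inclusion of the orbit of `x` and `E = G ×_{Stab(x)} M`, such a
family is determined by its member at `x`, via `e ↦ [g, φ (g⁻¹ e)]` on the stalk at `g x`
(`orbitCohom`, `stalkSkyscraperAdj`).

A monomorphism of `G`-sheaves is injective on stalks, since its kernel is again a `G`-sheaf
(`GSheaf.injective_of_mono`). So the stalk functors preserve monomorphisms and the skyscrapers of
injective modules are injective. The category of discrete `R[H]`-modules has enough injectives since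
the forgetful functor to `R`-modules has a right adjoint, which takes `I` to the uniformly locally
constant functions `H → I` (`forgetCoindAdj`).

All products of `G`-sheaves exist (`hasProduct`). The product is *not* the product of the underlying
sheaves, on which `G` need not act continuously: it consists of the germs of families of sections
that are invariant under translation by a common neighbourhood of `1`. It is built as a push forward
along the folding map `∐ X → X` of the disjoint union of the factors. Its universal property is
again that of cohomomorphisms, and holds because over the compact space `X` the sections of any
`G`-sheaf are locally invariant under some neighbourhood of `1`
(`Cohomomorphism.toPush_mem_smoothStalk`).

Finally, a map to the product of the skyscrapers with injective adjoint components is mono because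
maps of `G`-sheaves are determined by their values on one stalk for each orbit
(`GSheaf.hom_ext_of_representatives`).
-/

namespace EquivSheaf

/-! ### Local sections and germs -/

section LocalSections

variable {R G X : Type u} [Ring R] [Group G] [TopologicalSpace G] [TopologicalSpace X]
  [MulAction G X]

/-- The set-theoretic section `s` of `E` is continuous near `x`, so that it represents a germ of
sections at `x`. Its values away from `x` are irrelevant. -/
def GSheaf.IsSectionNear (E : GSheaf R G X) (x : X) (s : ∀ x, E.stalk x) : Prop :=
  ∀ᶠ z in 𝓝 x, ContinuousAt (fun z => (⟨z, s z⟩ : E.Total)) z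

theorem GSheaf.IsSectionNear.continuousAt {E : GSheaf R G X} {x : X} {s : ∀ x, E.stalk x}
    (hs : E.IsSectionNear x s) : ContinuousAt (fun z => (⟨z, s z⟩ : E.Total)) x :=
  hs.self_of_nhds

theorem GSheaf.IsSectionNear.eventually {E : GSheaf R G X} {x : X} {s : ∀ x, E.stalk x}
    (hs : E.IsSectionNear x s) : ∀ᶠ z in 𝓝 x, E.IsSectionNear z s :=
  eventually_eventually_nhds.2 hs

theorem GSheaf.IsSectionNear.add {E : GSheaf R G X} {x : X} {s t : ∀ x, E.stalk x}
    (hs : E.IsSectionNear x s) (ht : E.IsSectionNear x t) : E.IsSectionNear x (s + t) := by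
  filter_upwards [hs, ht] with z h₁ h₂ using E.continuousAt_add h₁ h₂

theorem GSheaf.IsSectionNear.smul {E : GSheaf R G X} {x : X} {s : ∀ x, E.stalk x} (r : R)
    (hs : E.IsSectionNear x s) : E.IsSectionNear x (r • s) := by
  filter_upwards [hs] with z h using (E.continuous_smul r).continuousAt.comp h

/-- The section `s` represents an element of the push forward along the identity. -/
theorem GSheaf.IsSectionNear.mem_sectionsNear_id {E : GSheaf R G X} {x : X} {s : ∀ x, E.stalk x}
    (hs : E.IsSectionNear x s) : s ∈ sectionsNear E id x := by
  change ∀ᶠ z in comap id (𝓝 x), _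
  rwa [comap_id]

theorem GSheaf.IsSectionNear.translate [IsTopologicalGroup G] [ContinuousSMul G X]
    {E : GSheaf R G X} {x x' : X} {s : ∀ x, E.stalk x} (hs : E.IsSectionNear x s) {g : G}
    (h : g • x = x') : E.IsSectionNear x' (E.translate g s) := by
  have h1 := translate_mem E (f := id) (fun _ _ => rfl) g h hs.mem_sectionsNear_id
  change ∀ᶠ z in comap id (𝓝 x'), _ at h1
  rwa [comap_id] at h1

/-- A form of `act_mul` in which the product is any element equal to `g * k`, which avoids
rewriting in dependent types. -/
theorem GSheaf.act_act (E : GSheaf R G X) {g k l : G} {x y z : X} (hk : k • x = y)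
    (hg : g • y = z) (hl : l • x = z) (h : g * k = l) (e : E.stalk x) :
    E.act g y z hg (E.act k x y hk e) = E.act l x z hl e := by
  subst h
  exact (E.act_mul g k x y z hk hg hl e).symm

theorem GSheaf.exists_section (E : GSheaf R G X) (x : X) (e : E.stalk x) :
    ∃ s, E.IsSectionNear x s ∧ s x = e := by
  classical
  obtain ⟨φ, hφ, hp⟩ := E.isLocalHomeomorph ⟨x, e⟩
  have hfst : ∀ z ∈ φ.target, (φ.symm z).1 = z := fun z hz =>
    (congrFun hp (φ.symm z)).trans (φ.right_inv hz)
  let s : ∀ z, E.stalk z := fun z =>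
    if hz : z ∈ φ.target then (hfst z hz) ▸ (φ.symm z).2 else 0
  have hs : ∀ z ∈ φ.target, (⟨z, s z⟩ : E.Total) = φ.symm z := by
    intro z hz
    have key : ∀ (q : E.Total) (h : q.1 = z), (⟨z, h ▸ q.2⟩ : E.Total) = q := by
      rintro q rfl
      rfl
    simp only [s, dif_pos hz]
    exact key _ _
  have hx : x ∈ φ.target := by
    have h := φ.map_source hφ
    rwa [← congrFun hp] at h
  refine ⟨s, ?_, ?_⟩
  · filter_upwards [φ.open_target.mem_nhds hx] with z hz
    refine (φ.symm.continuousAt hz).congr ?_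
    filter_upwards [φ.open_target.mem_nhds hz] with w hw using (hs w hw).symm
  · have h1 : (⟨x, s x⟩ : E.Total) = ⟨x, e⟩ := by
      rw [hs x hx]
      have h := φ.left_inv hφ
      rwa [← congrFun hp] at h
    exact eq_of_heq (Sigma.mk.inj h1).2

/-- Elements of `E` close to a value of the section `s` are values of `s`. -/
theorem GSheaf.eventually_eq_section (E : GSheaf R G X) {x : X} {s : ∀ x, E.stalk x}
    (hs : ContinuousAt (fun z => (⟨z, s z⟩ : E.Total)) x) :
    ∀ᶠ e in 𝓝 (⟨x, s x⟩ : E.Total), e.2 = s e.1 := by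
  have h1 : ContinuousAt (fun e : E.Total => (⟨e.1, s e.1⟩ : E.Total)) ⟨x, s x⟩ :=
    ContinuousAt.comp (f := fun e : E.Total => e.1) (g := fun z => (⟨z, s z⟩ : E.Total)) hs
      E.isLocalHomeomorph.continuous.continuousAt
  filter_upwards [eventually_eq_of_proj E.isLocalHomeomorph (a := id) continuousAt_id h1
    (fun _ => rfl) rfl] with e he
  exact eq_of_heq (Sigma.mk.inj he).2

theorem GSheaf.eventually_section_eq (E : GSheaf R G X) {x : X} {s t : ∀ x, E.stalk x}
    (hs : ContinuousAt (fun z => (⟨z, s z⟩ : E.Total)) x)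
    (ht : ContinuousAt (fun z => (⟨z, t z⟩ : E.Total)) x) (h : s x = t x) :
    ∀ᶠ z in 𝓝 x, s z = t z := by
  filter_upwards [eventually_eq_of_proj E.isLocalHomeomorph hs ht (fun _ => rfl)
    (by simp only [h])] with z hz
  exact eq_of_heq (Sigma.mk.inj hz).2

end LocalSections

section Cohomomorphisms

variable {R G X Y : Type u} [Ring R] [Group G] [TopologicalSpace G]
  [TopologicalSpace X] [TopologicalSpace Y] [MulAction G X] [MulAction G Y]

/-- The value at `y` of a germ at `f y` of sections over preimages. -/
def germEval (E : GSheaf R G Y) (f : Y → X) (y : Y) : PushStalk E f (f y) →ₗ[R] E.stalk y :=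
  Submodule.liftQ _ ((LinearMap.proj y).comp (sectionsNear E f (f y)).subtype) (by
    intro s hs
    have h : ∀ᶠ z in comap f (𝓝 (f y)), s.1 z = 0 := hs
    exact (tendsto_comap_iff.2 (tendsto_pure_nhds f y)).eventually h)

@[simp]
theorem germEval_germ (E : GSheaf R G Y) (f : Y → X) (y : Y) (s : sectionsNear E f (f y)) :
    germEval E f y (germ E f (f y) s) = s.1 y :=
  rfl

theorem germEval_pushAct [IsTopologicalGroup G] [ContinuousSMul G X] [ContinuousSMul G Y]
    (E : GSheaf R G Y) {f : Y → X} (hf : ∀ (g : G) y, f (g • y) = g • f y) (g : G) {y y' : Y}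
    (h : g • y = y') (h' : g • f y = f y') (e : PushStalk E f (f y)) :
    germEval E f y' (pushAct E hf g _ _ h' e) = E.act g y y' h (germEval E f y e) := by
  obtain ⟨t, rfl⟩ := germ_surj E f _ e
  exact E.translate_apply g t.1 h

/-- A section `s` near `x` and a germ `t` at `x` that correspond to each other under a continuous
family `θ` of maps to the stalks of the push forward correspond to each other near `x`. -/
theorem eventually_germEval_eq {K : GSheaf R G X} (E : GSheaf R G Y) (f : Y → X)
    {θ : ∀ x, K.stalk x → PushStalk E f x}
    (hθ : Continuous fun e : K.Total => (⟨e.1, θ e.1 e.2⟩ : Σ x, PushStalk E f x))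
    {x : X} {s : ∀ x, K.stalk x} (hs : K.IsSectionNear x s) {t : sectionsNear E f x}
    (hst : θ x (s x) = germ E f x t) :
    ∀ᶠ y in comap f (𝓝 x), germEval E f y (θ (f y) (s (f y))) = t.1 y := by
  obtain ⟨U, ht, hU, hx⟩ := exists_sheet E f x t
  have h1 : ContinuousAt (fun z => (⟨z, θ z (s z)⟩ : Σ x, PushStalk E f x)) x :=
    ContinuousAt.comp (f := fun z => (⟨z, s z⟩ : K.Total)) hθ.continuousAt hs.continuousAt
  have h2 : ∀ᶠ z in 𝓝 x, (⟨z, θ z (s z)⟩ : Σ x, PushStalk E f x) ∈ sheet E f U t.1 ht := by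
    refine h1.eventually_mem ((isOpen_sheet E f hU t.1 ht).mem_nhds ?_)
    simp only [hst]
    exact ⟨⟨x, hx⟩, rfl⟩
  filter_upwards [tendsto_comap.eventually h2]
  rintro y ⟨⟨z, hz⟩, h⟩
  obtain rfl : z = f y := congrArg Sigma.fst h
  rw [← eq_of_heq (Sigma.mk.inj h).2, germEval_germ]

/-- An `f`-cohomomorphism `K ⇝ E` along `f : Y → X` from a `G`-sheaf over `X` to one over `Y`:
an equivariant family of linear maps `K_{f y} → E_y` that takes sections of `K` to sections of `E`.
It amounts to a map `f⁻¹ K → E`, without the need to form `f⁻¹ K`. -/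
structure Cohomomorphism (K : GSheaf R G X) (E : GSheaf R G Y) (f : Y → X) where
  app : ∀ y, K.stalk (f y) →ₗ[R] E.stalk y
  continuousAt_app : ∀ (y : Y) (s : ∀ x, K.stalk x), K.IsSectionNear (f y) s →
    ContinuousAt (fun y => (⟨y, app y (s (f y))⟩ : E.Total)) y
  app_act : ∀ (g : G) (y y' : Y) (h : g • y = y') (h' : g • f y = f y') (e : K.stalk (f y)),
    app y' (K.act g (f y) (f y') h' e) = E.act g y y' h (app y e)

namespace Cohomomorphism

variable {K : GSheaf R G X} {E : GSheaf R G Y} {f : Y → X} (ψ : Cohomomorphism K E f)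

/-- The effect of a cohomomorphism on sections. -/
def mapSection (s : ∀ x, K.stalk x) (y : Y) : E.stalk y := ψ.app y (s (f y))

theorem mapSection_mem {x : X} {s : ∀ x, K.stalk x} (hs : K.IsSectionNear x s) :
    ψ.mapSection s ∈ sectionsNear E f x := by
  change ∀ᶠ y in comap f (𝓝 x), _
  filter_upwards [tendsto_comap.eventually hs.eventually] with y hy
  exact ψ.continuousAt_app y s hy

theorem mapSection_translate (hf : ∀ (g : G) y, f (g • y) = g • f y) (g : G)
    (s : ∀ x, K.stalk x) :
    ψ.mapSection (K.translate g s) = E.translate g (ψ.mapSection s) := by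
  ext y
  have h : g • f (g⁻¹ • y) = f y := by rw [← hf, smul_inv_smul]
  rw [E.translate_apply g _ (smul_inv_smul g y), mapSection, mapSection,
    K.translate_apply g s h, ψ.app_act g _ _ (smul_inv_smul g y)]

theorem germ_mapSection_eq {x : X} {s t : ∀ x, K.stalk x} (hs : K.IsSectionNear x s)
    (ht : K.IsSectionNear x t) (h : s x = t x) :
    germ E f x ⟨_, ψ.mapSection_mem hs⟩ = germ E f x ⟨_, ψ.mapSection_mem ht⟩ := by
  rw [germ_eq_iff]
  filter_upwards [tendsto_comap.eventually
    (K.eventually_section_eq hs.continuousAt ht.continuousAt h)] with y hy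
  simp only [mapSection, hy]

/-- The map from the stalks of `K` to those of the push forward of `E` that is adjoint to a
cohomomorphism: it takes the germ of a section to the germ of its image. -/
noncomputable def toPush (x : X) : K.stalk x →ₗ[R] PushStalk E f x where
  toFun e := germ E f x ⟨_, ψ.mapSection_mem (K.exists_section x e).choose_spec.1⟩
  map_add' e e' := by
    rw [ψ.germ_mapSection_eq (K.exists_section x _).choose_spec.1
      ((K.exists_section x e).choose_spec.1.add
      (K.exists_section x e').choose_spec.1)
      (by simp only [Pi.add_apply, (K.exists_section x _).choose_spec.2])]
    exact (germ_eq_iff _ _ _ _ (_ + _)).2 (Eventually.of_forall fun y => map_add _ _ _)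
  map_smul' r e := by
    rw [ψ.germ_mapSection_eq (K.exists_section x _).choose_spec.1
      ((K.exists_section x e).choose_spec.1.smul r)
      (by simp only [Pi.smul_apply, (K.exists_section x _).choose_spec.2])]
    exact (germ_eq_iff _ _ _ _ (r • _)).2 (Eventually.of_forall fun y => map_smul _ _ _)

theorem toPush_apply {x : X} {s : ∀ x, K.stalk x} (hs : K.IsSectionNear x s) :
    ψ.toPush x (s x) = germ E f x ⟨_, ψ.mapSection_mem hs⟩ :=
  ψ.germ_mapSection_eq (K.exists_section x (s x)).choose_spec.1 hs
    (K.exists_section x (s x)).choose_spec.2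

theorem germEval_toPush (y : Y) (e : K.stalk (f y)) :
    germEval E f y (ψ.toPush (f y) e) = ψ.app y e := by
  obtain ⟨s, hs, rfl⟩ := K.exists_section (f y) e
  rw [ψ.toPush_apply hs]
  rfl

theorem toPush_continuous :
    Continuous fun e : K.Total => (⟨e.1, ψ.toPush e.1 e.2⟩ : Σ x, PushStalk E f x) := by
  rw [continuous_iff_continuousAt]
  rintro ⟨x, e⟩
  obtain ⟨s, hs, rfl⟩ := K.exists_section x e
  obtain ⟨U, hsU, hU, hx⟩ := mem_nhds_iff.1 hs.eventually
  have ht : ∀ x ∈ U, ψ.mapSection s ∈ sectionsNear E f x :=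
    fun z hz => ψ.mapSection_mem (hsU hz)
  refine continuousAt_of_sheet (push_isOpenMap_fst E f)
    K.isLocalHomeomorph.continuous.continuousAt (isOpen_sheet E f hU _ ht)
    (injOn_sheet E f _ ht) ?_
  have h1 : ∀ᶠ e in 𝓝 (⟨x, s x⟩ : K.Total), e.1 ∈ U :=
    K.isLocalHomeomorph.continuous.continuousAt.eventually_mem (hU.mem_nhds hx)
  filter_upwards [K.eventually_eq_section hs.continuousAt, h1]
  rintro ⟨z, e⟩ he hz
  obtain rfl : e = s z := he
  rw [ψ.toPush_apply (hsU hz)]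
  exact ⟨⟨z, hz⟩, rfl⟩

theorem toPush_act [IsTopologicalGroup G] [ContinuousSMul G X] [ContinuousSMul G Y]
    (hf : ∀ (g : G) y, f (g • y) = g • f y) (g : G) (x x' : X) (h : g • x = x')
    (e : K.stalk x) :
    ψ.toPush x' (K.act g x x' h e) = pushAct E hf g x x' h (ψ.toPush x e) := by
  obtain ⟨s, hs, rfl⟩ := K.exists_section x e
  rw [← K.translate_apply g s h, ψ.toPush_apply (hs.translate h), ψ.toPush_apply hs,
    pushAct_germ]
  congr 2
  exact ψ.mapSection_translate hf g s

/-- A continuous family of maps to the stalks of the push forward is determined by its values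
under `germEval`. -/
theorem eq_toPush {θ : ∀ x, K.stalk x → PushStalk E f x}
    (hθ : Continuous fun e : K.Total => (⟨e.1, θ e.1 e.2⟩ : Σ x, PushStalk E f x))
    (h : ∀ y e, germEval E f y (θ (f y) e) = ψ.app y e) (x : X) (e : K.stalk x) :
    ψ.toPush x e = θ x e := by
  obtain ⟨s, hs, rfl⟩ := K.exists_section x e
  obtain ⟨t, ht⟩ := germ_surj E f x (θ x (s x))
  rw [ψ.toPush_apply hs, ← ht, germ_eq_iff]
  filter_upwards [eventually_germEval_eq E f hθ hs ht.symm] with y hy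
  rw [← hy, h]
  rfl

end Cohomomorphism

end Cohomomorphisms

/-! ### Open submodules and kernels -/

section OpenSubmodules

variable {R G X : Type u} [Ring R] [Group G] [TopologicalSpace G] [TopologicalSpace X]
  [MulAction G X]

/-- The `G`-sheaf given by a `G`-stable family of submodules `N x` of the stalks `F x` of a sheaf
space of `R`-modules whose total space is open. The group `G` acts on the ambient sheaf space, but
its action need only be continuous at the points of `N`. -/
def GSheaf.ofOpenSubmodules {F : X → Type u} [∀ x, AddCommGroup (F x)] [∀ x, Module R (F x)]
    [t : TopologicalSpace (Σ x, F x)]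
    (hp : IsLocalHomeomorph (Sigma.fst : (Σ x, F x) → X))
    (hsub : Continuous[fibreSquareTop F t, t] fun q => ⟨q.1, q.2.1 - q.2.2⟩)
    (hsmul : ∀ r : R, Continuous fun e : Σ x, F x => (⟨e.1, r • e.2⟩ : Σ x, F x))
    (act : ∀ (g : G) (x y : X), g • x = y → (F x →ₗ[R] F y))
    (act_one : ∀ (x : X) (h : (1 : G) • x = x) (e : F x), act 1 x x h e = e)
    (act_mul : ∀ (g k : G) (x y z : X) (hk : k • x = y) (hg : g • y = z) (hgk : (g * k) • x = z)
      (e : F x), act (g * k) x z hgk e = act g y z hg (act k x y hk e))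
    (N : ∀ x, Submodule R (F x)) (hN : IsOpen {e : Σ x, F x | e.2 ∈ N e.1})
    (hact : ∀ (g : G) (x y : X) (h : g • x = y), ∀ e ∈ N x, act g x y h e ∈ N y)
    (hcont : ∀ (g : G) (x : X), ∀ e ∈ N x, ContinuousAt (fun q : G × (Σ x, F x) =>
      (⟨q.1 • q.2.1, act q.1 q.2.1 (q.1 • q.2.1) rfl q.2.2⟩ : Σ x, F x)) (g, ⟨x, e⟩)) :
    GSheaf R G X where
  stalk x := N x
  top := TopologicalSpace.induced (fun e => ⟨e.1, e.2.1⟩) t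
  isLocalHomeomorph := by
    let _ : TopologicalSpace (Σ x, N x) :=
      TopologicalSpace.induced (fun e => (⟨e.1, e.2.1⟩ : Σ x, F x)) t
    have hj : IsOpenEmbedding (fun e : Σ x, N x => (⟨e.1, e.2.1⟩ : Σ x, F x)) := by
      refine ⟨⟨⟨rfl⟩, ?_⟩, ?_⟩
      · rintro ⟨x, e, he⟩ ⟨x', e', he'⟩ h
        obtain rfl : x = x' := congrArg Sigma.fst h
        obtain rfl : e = e' := eq_of_heq (Sigma.mk.inj h).2
        rfl
      · convert hN
        ext ⟨x, e⟩
        constructor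
        · rintro ⟨⟨x', e', he'⟩, h⟩
          rw [← h]
          exact he'
        · intro he
          exact ⟨⟨x, e, he⟩, rfl⟩
    exact hp.comp hj.isLocalHomeomorph
  continuous_sub := by
    let _ : TopologicalSpace (Σ x, N x) :=
      TopologicalSpace.induced (fun e => (⟨e.1, e.2.1⟩ : Σ x, F x)) t
    let _ := fibreSquareTop F t
    let _ := fibreSquareTop (fun x => N x) inferInstance
    have hj : Continuous (fun e : Σ x, N x => (⟨e.1, e.2.1⟩ : Σ x, F x)) := continuous_induced_dom
    have hi : Continuous (fun q : Σ x, N x × N x =>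
        ((⟨q.1, q.2.1⟩, ⟨q.1, q.2.2⟩) : (Σ x, N x) × (Σ x, N x))) := continuous_induced_dom
    rw [continuous_induced_rng]
    have h1 : Continuous (fun q : Σ x, N x × N x =>
        (⟨q.1, (q.2.1.1, q.2.2.1)⟩ : Σ x, F x × F x)) := by
      rw [continuous_induced_rng]
      exact (hj.comp (continuous_fst.comp hi)).prodMk (hj.comp (continuous_snd.comp hi))
    exact Continuous.comp (f := fun q : Σ x, N x × N x =>
      (⟨q.1, (q.2.1.1, q.2.2.1)⟩ : Σ x, F x × F x)) hsub h1
  continuous_smul r := by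
    let _ : TopologicalSpace (Σ x, N x) :=
      TopologicalSpace.induced (fun e => (⟨e.1, e.2.1⟩ : Σ x, F x)) t
    rw [continuous_induced_rng]
    exact (hsmul r).comp (f := fun e : Σ x, N x => (⟨e.1, e.2.1⟩ : Σ x, F x))
      continuous_induced_dom
  act g x y h := (act g x y h).restrict (hact g x y h)
  act_one x h e := Subtype.ext (act_one x h e.1)
  act_mul g k x y z hk hg hgk e := Subtype.ext (act_mul g k x y z hk hg hgk e.1)
  continuous_act := by
    let _ : TopologicalSpace (Σ x, N x) :=
      TopologicalSpace.induced (fun e => (⟨e.1, e.2.1⟩ : Σ x, F x)) t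
    have hj : Continuous (fun e : Σ x, N x => (⟨e.1, e.2.1⟩ : Σ x, F x)) := continuous_induced_dom
    rw [continuous_induced_rng, continuous_iff_continuousAt]
    rintro ⟨g, x, e⟩
    have h1 : Continuous fun q : G × (Σ x, N x) => (q.1, (⟨q.2.1, q.2.2.1⟩ : Σ x, F x)) :=
      continuous_fst.prodMk (hj.comp continuous_snd)
    exact ContinuousAt.comp (f := fun q : G × (Σ x, N x) => (q.1, (⟨q.2.1, q.2.2.1⟩ : Σ x, F x)))
      (x := ((g, ⟨x, e⟩) : G × (Σ x, N x))) (hcont g x e.1 e.2) h1.continuousAt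

theorem GSheaf.isOpen_zeros (E : GSheaf R G X) : IsOpen {e : E.Total | e.2 = 0} := by
  rw [isOpen_iff_mem_nhds]
  rintro ⟨x, e⟩ (rfl : e = 0)
  exact E.eventually_eq_section (s := 0) E.continuous_zero.continuousAt

theorem GSheaf.mono_of_injective {E F : GSheaf R G X} (φ : E ⟶ F)
    (h : ∀ x, Function.Injective (φ.app x)) : Mono φ :=
  ⟨fun α β hαβ => GSheaf.hom_ext _ _ fun x e => h x (by
    have h1 := congrArg (fun γ : GSheaf.Hom _ _ => γ.app x e) hαβ
    exact h1)⟩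

/-- The kernel of a map of `G`-sheaves. -/
def GSheaf.ker {E F : GSheaf R G X} (φ : E ⟶ F) : GSheaf R G X :=
  GSheaf.ofOpenSubmodules E.isLocalHomeomorph E.continuous_sub E.continuous_smul E.act E.act_one
    E.act_mul (fun x => LinearMap.ker (φ.app x)) (F.isOpen_zeros.preimage φ.continuous_app)
    (fun g x y h e he => by
      rw [LinearMap.mem_ker, φ.app_act, LinearMap.mem_ker.1 he, map_zero])
    (fun _ _ _ _ => E.continuous_act.continuousAt)

/-- The inclusion of the kernel. -/
def GSheaf.kerι {E F : GSheaf R G X} (φ : E ⟶ F) : GSheaf.ker φ ⟶ E :=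
  { app := fun x => (LinearMap.ker (φ.app x)).subtype
    continuous_app := continuous_induced_dom
    app_act := fun _ _ _ _ _ => rfl }

/-- The zero map between two `G`-sheaves. -/
def GSheaf.zeroHom (E F : GSheaf R G X) : E ⟶ F :=
  { app := fun _ => 0
    continuous_app := F.continuous_zero.comp E.isLocalHomeomorph.continuous
    app_act := fun _ _ _ _ _ => (map_zero _).symm }

/-- Monomorphisms of `G`-sheaves are injective on stalks: their kernel sheaf has no nonzero
stalks. -/
theorem GSheaf.injective_of_mono {E F : GSheaf R G X} (φ : E ⟶ F) [Mono φ] (x : X) :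
    Function.Injective (φ.app x) := by
  rw [← LinearMap.ker_eq_bot, LinearMap.ker_eq_bot']
  intro e he
  have h1 : GSheaf.kerι φ ≫ φ = GSheaf.zeroHom _ E ≫ φ := by
    ext x e
    change φ.app x e.1 = φ.app x 0
    rw [map_zero]
    exact e.2
  have h2 := (cancel_mono φ).1 h1
  exact congrArg (fun γ : GSheaf.Hom (GSheaf.ker φ) E => γ.app x ⟨e, he⟩) h2

end OpenSubmodules

/-! ### Discrete modules -/

section DiscreteModules

variable {R H : Type u} [Ring R] [Group H] [TopologicalSpace H]

variable (R H) in
/-- The underlying `R`-module of a discrete `R[H]`-module. -/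
def forgetDiscrete : DiscreteModule R H ⥤ ModuleCat.{u} R :=
  (isDiscrete R H).ι ⋙ Action.forget _ _

instance : (forgetDiscrete R H).Faithful :=
  inferInstanceAs ((isDiscrete R H).ι ⋙ Action.forget _ _).Faithful

/-- The submodule `N` of an `R[H]`-module `M`, as an `R[H]`-module. -/
def subRep (M : Action (ModuleCat.{u} R) H) (N : Submodule R M.V)
    (hN : ∀ h, ∀ m ∈ N, smulMap M h m ∈ N) : Action (ModuleCat.{u} R) H where
  V := ModuleCat.of R N
  ρ :=
    { toFun := fun h => ModuleCat.ofHom ((smulMap M h).restrict (hN h))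
      map_one' := ModuleCat.hom_ext (LinearMap.ext fun m => Subtype.ext (smulMap_one M m.1))
      map_mul' := fun h k => ModuleCat.hom_ext
        (LinearMap.ext fun m => Subtype.ext (smulMap_mul M h k m.1)) }

/-- A module is discrete if its orbit maps are locally constant. -/
theorem isDiscrete_iff (M : Action (ModuleCat.{u} R) H) :
    isDiscrete R H M ↔ ∀ (m : M.V) (h : H), ∀ᶠ k in 𝓝 h, smulMap M k m = smulMap M h m := by
  let _ : TopologicalSpace M.V := ⊥
  have : DiscreteTopology M.V := ⟨rfl⟩
  refine (continuous_prod_of_discrete_right (f := fun q : H × M.V => smulMap M q.1 q.2)).trans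
    (forall_congr' fun m => ?_)
  rw [continuous_iff_continuousAt]
  refine forall_congr' fun h => ?_
  rw [ContinuousAt, nhds_discrete M.V, tendsto_pure]

theorem subRep_isDiscrete {M : Action (ModuleCat.{u} R) H} (hM : isDiscrete R H M)
    (N : Submodule R M.V) (hN : ∀ h, ∀ m ∈ N, smulMap M h m ∈ N) :
    isDiscrete R H (subRep M N hN) := by
  rw [isDiscrete_iff] at hM ⊢
  intro m h
  filter_upwards [hM m.1 h] with k hk using Subtype.ext hk

theorem smulMap_hom {M N : Action (ModuleCat.{u} R) H} (φ : M ⟶ N) (h : H) (m : M.V) :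
    φ.hom.hom (smulMap M h m) = smulMap N h (φ.hom.hom m) :=
  congrArg (fun ψ : M.V ⟶ N.V => ψ.hom m) (φ.comm h)

theorem DiscreteModule.injective_of_mono {M N : DiscreteModule R H} (φ : M ⟶ N) [Mono φ] :
    Function.Injective φ.hom.hom.hom := by
  rw [← LinearMap.ker_eq_bot, LinearMap.ker_eq_bot']
  intro m hm
  have hK : ∀ h, ∀ m ∈ LinearMap.ker φ.hom.hom.hom,
      smulMap M.obj h m ∈ LinearMap.ker φ.hom.hom.hom := fun h m hm => by
    rw [LinearMap.mem_ker, smulMap_hom, LinearMap.mem_ker.1 hm, map_zero]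
  let K : DiscreteModule R H := ⟨_, subRep_isDiscrete M.property _ hK⟩
  let α : K ⟶ M := ObjectProperty.homMk
    { hom := ModuleCat.ofHom (Submodule.subtype _), comm := fun _ => rfl }
  let β : K ⟶ M := ObjectProperty.homMk
    { hom := ModuleCat.ofHom 0
      comm := fun h => ModuleCat.hom_ext
        (LinearMap.ext fun k => (map_zero (smulMap M.obj h)).symm) }
  have h1 : α ≫ φ = β ≫ φ := by
    apply (forgetDiscrete R H).map_injective
    refine ModuleCat.hom_ext (LinearMap.ext fun k => ?_)
    change φ.hom.hom.hom k.1 = φ.hom.hom.hom 0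
    rw [map_zero]
    exact k.2
  have h2 := (cancel_mono φ).1 h1
  exact congrArg (fun γ : K ⟶ M => γ.hom.hom.hom ⟨m, hm⟩) h2

instance : (forgetDiscrete R H).PreservesMonomorphisms where
  preserves φ _ := (ModuleCat.mono_iff_injective _).2 (DiscreteModule.injective_of_mono φ)

theorem DiscreteModule.mono_of_injective {M N : DiscreteModule R H} (φ : M ⟶ N)
    (h : Function.Injective φ.hom.hom.hom) : Mono φ :=
  (forgetDiscrete R H).mono_of_mono_map ((ModuleCat.mono_iff_injective _).2 h)

variable [IsTopologicalGroup H]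

variable (H) in
/-- The functions `H → I` that are invariant under right translation by some neighbourhood
of `1`. -/
def uniformlyLocallyConstant (I : Type u) [AddCommGroup I] [Module R I] :
    Submodule R (H → I) where
  carrier := {f | ∀ᶠ v in 𝓝 (1 : H), ∀ k, f (k * v) = f k}
  zero_mem' := Set.mem_ofPred_eq ▸ Eventually.of_forall fun _ _ => rfl
  add_mem' hs ht := by
    rw [Set.mem_ofPred_eq] at hs ht ⊢
    filter_upwards [hs, ht] with v h1 h2 k
    simp [h1, h2]
  smul_mem' r s hs := by
    rw [Set.mem_ofPred_eq] at hs ⊢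
    filter_upwards [hs] with v h k
    simp [h]

theorem comp_mul_mem {I : Type u} [AddCommGroup I] [Module R I] (h : H) {f : H → I}
    (hf : f ∈ uniformlyLocallyConstant (R := R) H I) :
    (fun k => f (k * h)) ∈ uniformlyLocallyConstant (R := R) H I := by
  have hf' : ∀ᶠ v in 𝓝 (1 : H), ∀ k, f (k * v) = f k := hf
  have h1 : Tendsto (fun v : H => h⁻¹ * v * h) (𝓝 1) (𝓝 1) := by
    have : Continuous fun v : H => h⁻¹ * v * h := by fun_prop
    simpa using this.tendsto 1
  change ∀ᶠ v in 𝓝 (1 : H), ∀ k, f (k * v * h) = f (k * h)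
  filter_upwards [h1.eventually hf'] with v hv k
  rw [← hv (k * h)]
  congr 1
  group

/-- The module of uniformly locally constant functions `H → I` with `(h f) k = f (k h)`. -/
def coindRep (I : ModuleCat.{u} R) : Action (ModuleCat.{u} R) H where
  V := ModuleCat.of R (uniformlyLocallyConstant (R := R) H I)
  ρ :=
    { toFun := fun h => ModuleCat.ofHom
        ((LinearMap.funLeft R I fun k => k * h).restrict fun _ hf => comp_mul_mem h hf)
      map_one' := ModuleCat.hom_ext (LinearMap.ext fun f => Subtype.ext (funext fun k =>
        congrArg f.1 (mul_one k)))
      map_mul' := fun h k => ModuleCat.hom_ext (LinearMap.ext fun f => Subtype.ext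
        (funext fun l => congrArg f.1 (mul_assoc l h k).symm)) }

theorem coindRep_isDiscrete (I : ModuleCat.{u} R) : isDiscrete R H (coindRep I) := by
  rw [isDiscrete_iff]
  intro f h
  have hf : ∀ᶠ v in 𝓝 (1 : H), ∀ k, f.1 (k * v) = f.1 k := f.2
  have h1 : Tendsto (fun v : H => h⁻¹ * v) (𝓝 h) (𝓝 1) := by
    have : Continuous fun v : H => h⁻¹ * v := by fun_prop
    simpa using this.tendsto h
  filter_upwards [h1.eventually hf] with v hv
  refine Subtype.ext (funext fun k => ?_)
  change f.1 (k * v) = f.1 (k * h)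
  rw [← hv (k * h)]
  group

variable (R H) in
/-- Discrete coinduction: the functor that takes an `R`-module `I` to the discrete `R[H]`-module of
uniformly locally constant functions `H → I`. -/
def coind : ModuleCat.{u} R ⥤ DiscreteModule R H where
  obj I := ⟨coindRep I, coindRep_isDiscrete I⟩
  map {I J} φ := ObjectProperty.homMk
    { hom := ModuleCat.ofHom ((φ.hom.compLeft H).restrict fun f hf => by
        have hf' : ∀ᶠ v in 𝓝 (1 : H), ∀ k, f (k * v) = f k := hf
        change ∀ᶠ v in 𝓝 (1 : H), ∀ k, φ.hom (f (k * v)) = φ.hom (f k)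
        filter_upwards [hf'] with v hv k
        rw [hv])
      comm := fun _ => rfl }

variable (R H) in
/-- Discrete coinduction is right adjoint to the forgetful functor: a linear map `φ : M → I`
corresponds to `m ↦ (k ↦ φ (k m))`. -/
def forgetCoindAdj : forgetDiscrete R H ⊣ coind R H :=
  Adjunction.mkOfHomEquiv
    { homEquiv := fun M I =>
        { toFun := fun φ => ObjectProperty.homMk
            { hom := ModuleCat.ofHom (LinearMap.codRestrict _
                (LinearMap.pi fun k => φ.hom.comp (smulMap M.obj k)) fun m => by
                  have h1 := (isDiscrete_iff M.obj).1 M.property m 1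
                  change ∀ᶠ v in 𝓝 (1 : H), ∀ k,
                    φ.hom (smulMap M.obj (k * v) m) = φ.hom (smulMap M.obj k m)
                  filter_upwards [h1] with v hv k
                  rw [smulMap_mul, hv, smulMap_one])
              comm := fun h => ModuleCat.hom_ext (LinearMap.ext fun m => Subtype.ext
                (funext fun k => congrArg φ.hom (smulMap_mul M.obj k h m).symm)) }
          invFun := fun φ => ModuleCat.ofHom
            (((LinearMap.proj (1 : H)).comp (Submodule.subtype _)).comp φ.hom.hom.hom)
          left_inv := fun φ => ModuleCat.hom_ext (LinearMap.ext fun m =>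
            congrArg φ.hom (smulMap_one M.obj m))
          right_inv := fun φ => by
            apply (forgetDiscrete R H).map_injective
            refine ModuleCat.hom_ext (LinearMap.ext fun m => Subtype.ext (funext fun k => ?_))
            have h1 := congrArg (fun f : uniformlyLocallyConstant (R := R) H I => f.1 1)
              (smulMap_hom φ.hom k m)
            exact h1.trans (congrArg (φ.hom.hom.hom m).1 (one_mul k)) }
      homEquiv_naturality_left_symm := fun _ _ => rfl
      homEquiv_naturality_right := fun _ _ => rfl }

/-- The forgetful functor to `R`-modules preserves and reflects monomorphisms, so that enough
injectives are obtained by coinduction. -/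
instance : EnoughInjectives (DiscreteModule R H) :=
  EnoughInjectives.of_adjunction (forgetCoindAdj R H)

end DiscreteModules

section Stalks

variable {R G X : Type u} [Ring R] [Group G] [TopologicalSpace G] [TopologicalSpace X]
  [MulAction G X]

instance (x : X) : (stalkFunctor R G x).PreservesMonomorphisms where
  preserves φ _ := DiscreteModule.mono_of_injective _ (GSheaf.injective_of_mono φ x)

end Stalks

/-! ### The adjunction between stalks and equivariant skyscrapers -/

section Adjunction

variable {R G X : Type u} [Ring R] [Group G] [TopologicalSpace G] [IsTopologicalGroup G]
  [CompactSpace G] [TopologicalSpace X] [T2Space X] [MulAction G X] [ContinuousSMul G X] {x : X}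

/-- The point `x` of its orbit. -/
abbrev orbitPoint (G : Type u) [Group G] [MulAction G X] (x : X) : MulAction.orbit G x :=
  ⟨x, MulAction.mem_orbit_self x⟩

/-- The lift `1 : G` of the point `x` of its orbit. -/
def oneLift (G : Type u) [Group G] [MulAction G X] (x : X) : Lifts G x (orbitPoint G x) :=
  ⟨1, one_smul G x⟩

/-- The isomorphism `M ≅ (G ×_{Stab(x)} M)_x`, `m ↦ [1, m]`. -/
noncomputable def indOneEquiv (M : Action (ModuleCat.{u} R) (MulAction.stabilizer G x)) :
    M.V ≃ₗ[R] IndStalk M (orbitPoint G x) :=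
  { indEquiv M (oneLift G x) with
    map_add' := indMk_add M (oneLift G x)
    map_smul' := indMk_smul M (oneLift G x) }

theorem indOneEquiv_apply (M : Action (ModuleCat.{u} R) (MulAction.stabilizer G x)) (m : M.V) :
    indOneEquiv M m = indMk M (oneLift G x) m :=
  rfl

theorem indAct_indOneEquiv (M : Action (ModuleCat.{u} R) (MulAction.stabilizer G x))
    {y : MulAction.orbit G x} (g : Lifts G x y) (h : g.1 • orbitPoint G x = y) (m : M.V) :
    indAct M g.1 _ y h (indOneEquiv M m) = indMk M g m := by
  rw [indOneEquiv_apply, indAct_mk]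
  congr 1
  exact Subtype.ext (mul_one _)

theorem indAct_stabilizer (M : Action (ModuleCat.{u} R) (MulAction.stabilizer G x))
    (k : MulAction.stabilizer G x) (h : k.1 • orbitPoint G x = orbitPoint G x) (m : M.V) :
    indAct M k.1 _ _ h (indOneEquiv M m) = indOneEquiv M (smulMap M k m) := by
  rw [indOneEquiv_apply, indAct_mk, indOneEquiv_apply]
  refine (indMk_eq_iff _ _ _ _ _).2 ?_
  congr 1
  apply congrArg
  apply Subtype.ext
  change k.1 = (1 : G)⁻¹ * (k.1 * 1)
  simp

variable {K : GSheaf R G X} {M : DiscreteModule R (MulAction.stabilizer G x)}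

theorem Lifts.inv_smul {y : MulAction.orbit G x} (g : Lifts G x y) : g.1⁻¹ • y.1 = x :=
  inv_smul_eq_iff.2 g.2.symm

/-- The linear map underlying a map `K_x → M` of discrete `R[Stab(x)]`-modules. -/
def stalkMap (φ : (stalkFunctor R G x).obj K ⟶ M) : K.stalk x →ₗ[R] M.obj.V := φ.hom.hom.hom

theorem stalkMap_act (φ : (stalkFunctor R G x).obj K ⟶ M) (k : MulAction.stabilizer G x)
    (h : k.1 • x = x) (e : K.stalk x) :
    stalkMap φ (K.act k.1 x x h e) = smulMap M.obj k (stalkMap φ e) :=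
  smulMap_hom φ.hom k e

/-- The class `[g, φ (g⁻¹ e)]` does not depend on the choice of the lift `g`. -/
theorem indMk_act_eq (φ : (stalkFunctor R G x).obj K ⟶ M) {y : MulAction.orbit G x}
    (g g' : Lifts G x y) (e : K.stalk y.1) :
    indMk M.obj g (stalkMap φ (K.act g.1⁻¹ y.1 x g.inv_smul e)) =
      indMk M.obj g' (stalkMap φ (K.act g'.1⁻¹ y.1 x g'.inv_smul e)) := by
  rw [indMk_eq_iff, ← stalkMap_act φ _ (MulAction.mem_stabilizer_iff.1 (liftDiff g' g).2)]
  exact congrArg (stalkMap φ) (K.act_act _ _ _ (by simp [liftDiff]) e).symm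

/-- The linear map `m ↦ [g, m]` to the fibre over `g x`. -/
def indLinear (M : Action (ModuleCat.{u} R) (MulAction.stabilizer G x))
    {y : MulAction.orbit G x} (g : Lifts G x y) : M.V →ₗ[R] IndStalk M y where
  toFun := indMk M g
  map_add' := indMk_add M g
  map_smul' := indMk_smul M g

/-- The map `e ↦ [g, φ (g⁻¹ e)]` on the stalk at `y = g x`. -/
noncomputable def orbitApp (φ : (stalkFunctor R G x).obj K ⟶ M) (y : MulAction.orbit G x) :
    K.stalk y.1 →ₗ[R] IndStalk M.obj y :=
  (indLinear M.obj (Classical.arbitrary (Lifts G x y))).comp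
    ((stalkMap φ).comp (K.act (Classical.arbitrary (Lifts G x y)).1⁻¹ y.1 x (Lifts.inv_smul _)))

theorem orbitApp_apply (φ : (stalkFunctor R G x).obj K ⟶ M) {y : MulAction.orbit G x}
    (g : Lifts G x y) (e : K.stalk y.1) :
    orbitApp φ y e = indMk M.obj g (stalkMap φ (K.act g.1⁻¹ y.1 x g.inv_smul e)) :=
  indMk_act_eq φ (Classical.arbitrary (Lifts G x y)) g e

/-- Translates of the values of a section back to the stalk at `x` are locally constant. -/
theorem eventually_act_inv_eq (K : GSheaf R G X) (g : G) {s : ∀ x, K.stalk x}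
    (hs : K.IsSectionNear (g • x) s) :
    ∀ᶠ k in 𝓝 g, K.act k⁻¹ (k • x) x (inv_smul_smul k x) (s (k • x)) =
      K.act g⁻¹ (g • x) x (inv_smul_smul g x) (s (g • x)) := by
  have h1 : ContinuousAt (fun k : G => (⟨k • x, s (k • x)⟩ : K.Total)) g :=
    ContinuousAt.comp (f := fun k : G => k • x) (g := fun z => (⟨z, s z⟩ : K.Total))
      hs.continuousAt (continuous_id.smul continuous_const).continuousAt
  have h2 : ContinuousAt (fun k : G =>
      (⟨x, K.act k⁻¹ (k • x) x (inv_smul_smul k x) (s (k • x))⟩ : K.Total)) g := by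
    have h3 : (fun k : G =>
        (⟨x, K.act k⁻¹ (k • x) x (inv_smul_smul k x) (s (k • x))⟩ : K.Total)) =
        fun k => ⟨k⁻¹ • k • x, K.act k⁻¹ (k • x) _ rfl (s (k • x))⟩ := by
      ext1 k
      exact K.act_total _ _ _ _ _
    rw [h3]
    exact ContinuousAt.comp (f := fun k : G => ((k⁻¹, ⟨k • x, s (k • x)⟩) : G × K.Total))
      K.continuous_act.continuousAt (continuous_inv.continuousAt.prodMk h1)
  filter_upwards [eventually_eq_of_proj K.isLocalHomeomorph h2 continuousAt_const
    (fun _ => rfl) rfl] with k hk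
  exact eq_of_heq (Sigma.mk.inj hk).2

/-- A map `φ : K_x → M` of discrete `R[Stab(x)]`-modules gives a map from the restriction of `K`
to the orbit of `x` to `G ×_{Stab(x)} M`, by `e ↦ [g, φ (g⁻¹ e)]` for `e` in the stalk
at `g x`. -/
noncomputable def orbitCohom (φ : (stalkFunctor R G x).obj K ⟶ M) :
    Cohomomorphism K (inducedObj M) (Subtype.val : MulAction.orbit G x → X) where
  app := orbitApp φ
  continuousAt_app y s hs := by
    let _ : TopologicalSpace M.obj.V := ⊥
    obtain ⟨_, g, rfl⟩ := y
    -- The orbit map is open, so continuity at `g x` can be checked after pulling back to `G`.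
    have hopen : IsOpenMap fun g : G => g • orbitPoint G x := isOpenMap_smul_of_sigmaCompact _
    refine Tendsto.mono_left ?_ (hopen.nhds_le g)
    rw [tendsto_map'_iff]
    change ContinuousAt (fun k : G => (⟨k • orbitPoint G x, orbitApp φ _ (s (k • x))⟩ :
      Σ y, IndStalk M.obj y)) g
    have h1 : (fun k : G => (⟨k • orbitPoint G x, orbitApp φ _ (s (k • x))⟩ :
        Σ y, IndStalk M.obj y)) = fun k => indQuot M.obj
          (k, stalkMap φ (K.act k⁻¹ (k • x) x (inv_smul_smul k x) (s (k • x)))) := by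
      ext1 k
      let l : Lifts G x (k • orbitPoint G x) := ⟨k, rfl⟩
      exact (congrArg (fun e => (⟨k • orbitPoint G x, e⟩ : Σ y, IndStalk M.obj y))
        (orbitApp_apply φ l _)).trans (indQuot_eq M.obj l _).symm
    rw [h1]
    have h2 : ContinuousAt (fun k : G =>
        (k, stalkMap φ (K.act k⁻¹ (k • x) x (inv_smul_smul k x) (s (k • x))))) g := by
      refine continuousAt_id.prodMk (tendsto_nhds_of_eventually_eq ?_)
      filter_upwards [eventually_act_inv_eq K g hs] with k hk
      rw [hk]
    exact ContinuousAt.comp (f := fun k : G =>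
      (k, stalkMap φ (K.act k⁻¹ (k • x) x (inv_smul_smul k x) (s (k • x)))))
      (indQuot_isOpenQuotientMap M.obj).continuous.continuousAt h2
  app_act g y y' h h' e := by
    let l := Classical.arbitrary (Lifts G x y)
    refine (orbitApp_apply φ (liftMul g h l) _).trans (Eq.trans ?_
      (congrArg (indAct M.obj g y y' h) (orbitApp_apply φ l e)).symm)
    refine Eq.trans ?_ (indAct_mk M.obj g y y' h l _).symm
    refine congrArg (fun m => indMk M.obj _ (stalkMap φ m)) ?_
    exact K.act_act _ _ _ (by simp [liftMul]) e

variable (M) in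
/-- The counit of the adjunction: the value `[1, m]` at `x` of a germ at `x` is taken to `m`. -/
noncomputable def skyscraperCounit :
    (stalkFunctor R G x).obj ((skyscraper R G x).obj M) ⟶ M :=
  ObjectProperty.homMk
    { hom := ModuleCat.ofHom ((indOneEquiv M.obj).symm.toLinearMap.comp
        (germEval (inducedObj M) (Subtype.val : MulAction.orbit G x → X) (orbitPoint G x)))
      comm := fun k => ModuleCat.hom_ext (LinearMap.ext fun e => by
        have hk : k.1 • orbitPoint G x = orbitPoint G x := Subtype.ext k.2
        refine (congrArg (indOneEquiv M.obj).symm (germEval_pushAct (inducedObj M)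
          (f := (Subtype.val : MulAction.orbit G x → X)) (fun _ _ => rfl) k.1 hk k.2 e)).trans ?_
        refine (LinearEquiv.symm_apply_eq _).2 (Eq.trans ?_ (indAct_stabilizer M.obj k hk _))
        exact congrArg (indAct M.obj k.1 _ _ hk) (LinearEquiv.apply_symm_apply _ _).symm) }

/-- The map of `G`-sheaves adjoint to a map of discrete `R[Stab(x)]`-modules. -/
noncomputable def toSkyscraper (φ : (stalkFunctor R G x).obj K ⟶ M) :
    K ⟶ (skyscraper R G x).obj M :=
  { app := (orbitCohom φ).toPush
    continuous_app := (orbitCohom φ).toPush_continuous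
    app_act := (orbitCohom φ).toPush_act fun _ _ => rfl }

theorem germEval_toSkyscraper (φ : (stalkFunctor R G x).obj K ⟶ M) (y : MulAction.orbit G x)
    (e : K.stalk y.1) :
    germEval (inducedObj M) (Subtype.val : MulAction.orbit G x → X) y
      ((toSkyscraper φ).app y.1 e) = orbitApp φ y e :=
  (orbitCohom φ).germEval_toPush y e

/-- A map `θ` to a skyscraper, followed by evaluation of germs at the points of the orbit, is the
map given by the component of `θ` at `x` only. This is equivariance of `θ` and of evaluation. -/
theorem orbitApp_stalk_counit (θ : K ⟶ (skyscraper R G x).obj M) (y : MulAction.orbit G x)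
    (e : K.stalk y.1) :
    germEval (inducedObj M) (Subtype.val : MulAction.orbit G x → X) y (θ.app y.1 e) =
      orbitApp ((stalkFunctor R G x).map θ ≫ skyscraperCounit M) y e := by
  let f : MulAction.orbit G x → X := Subtype.val
  let l := Classical.arbitrary (Lifts G x y)
  have hl : l.1 • orbitPoint G x = y := Subtype.ext l.2
  have hl' : l.1⁻¹ • y = orbitPoint G x := Subtype.ext l.inv_smul
  refine Eq.symm ((orbitApp_apply _ l e).trans ?_)
  rw [← indAct_indOneEquiv M.obj l hl]
  have h1 : indOneEquiv M.obj (stalkMap ((stalkFunctor R G x).map θ ≫ skyscraperCounit M)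
      (K.act l.1⁻¹ y.1 x l.inv_smul e)) =
      germEval (inducedObj M) f (orbitPoint G x) (θ.app x (K.act l.1⁻¹ y.1 x l.inv_smul e)) :=
    LinearEquiv.apply_symm_apply _ _
  have h2 : θ.app x (K.act l.1⁻¹ y.1 x l.inv_smul e) =
      pushAct (inducedObj M) (f := f) (fun _ _ => rfl) l.1⁻¹ y.1 x l.inv_smul (θ.app y.1 e) :=
    θ.app_act _ _ _ _ _
  rw [h1, h2]
  refine (congrArg (indAct M.obj l.1 _ y hl) (germEval_pushAct (inducedObj M) (f := f)
    (fun _ _ => rfl) l.1⁻¹ hl' l.inv_smul _)).trans ?_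
  exact ((inducedObj M).act_act hl' hl (one_smul G y) (mul_inv_cancel l.1) _).trans
    ((inducedObj M).act_one y _ _)

theorem stalk_toSkyscraper_counit (φ : (stalkFunctor R G x).obj K ⟶ M) :
    (stalkFunctor R G x).map (toSkyscraper φ) ≫ skyscraperCounit M = φ := by
  apply (forgetDiscrete R _).map_injective
  refine ModuleCat.hom_ext (LinearMap.ext fun e => ?_)
  have h1 := (germEval_toSkyscraper φ (orbitPoint G x) e).trans
    (orbitApp_apply φ (oneLift G x) e)
  refine (congrArg (indOneEquiv M.obj).symm h1).trans
    (((indOneEquiv M.obj).symm_apply_apply _).trans ?_)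
  refine congrArg (stalkMap φ) ?_
  have h2 : ∀ (g : G) (h : g • x = x), g = 1 → K.act g x x h e = e := by
    rintro g h rfl
    exact K.act_one x h e
  exact h2 _ _ inv_one

theorem toSkyscraper_stalk_counit (θ : K ⟶ (skyscraper R G x).obj M) :
    toSkyscraper ((stalkFunctor R G x).map θ ≫ skyscraperCounit M) = θ :=
  GSheaf.hom_ext _ _ fun z e =>
    (orbitCohom _).eq_toPush (θ := fun z e => θ.app z e) θ.continuous_app
      (orbitApp_stalk_counit θ) z e

theorem toSkyscraper_comp (φ : (stalkFunctor R G x).obj K ⟶ M)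
    {N : DiscreteModule R (MulAction.stabilizer G x)} (α : M ⟶ N) :
    toSkyscraper (φ ≫ α) = toSkyscraper φ ≫ (skyscraper R G x).map α := by
  refine GSheaf.hom_ext _ _ fun z e => ?_
  obtain ⟨s, hs, rfl⟩ := K.exists_section z e
  refine ((orbitCohom (φ ≫ α)).toPush_apply hs).trans (Eq.symm ?_)
  refine (congrArg (pushApp ((induced R G x).map α) (Subtype.val : MulAction.orbit G x → X) z)
    ((orbitCohom φ).toPush_apply hs)).trans ?_
  rfl

variable (R G) in
/-- The stalk functor at `x` is left adjoint to the equivariant skyscraper functor at `x`. -/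
noncomputable def stalkSkyscraperAdj (x : X) : stalkFunctor R G x ⊣ skyscraper R G x :=
  Adjunction.mkOfHomEquiv
    { homEquiv := fun _ M =>
        { toFun := toSkyscraper
          invFun := fun θ => (stalkFunctor R G x).map θ ≫ skyscraperCounit M
          left_inv := stalk_toSkyscraper_counit
          right_inv := toSkyscraper_stalk_counit }
      homEquiv_naturality_left_symm := fun f g => by
        change (stalkFunctor R G x).map (f ≫ g) ≫ _ = _ ≫ (stalkFunctor R G x).map g ≫ _
        rw [Functor.map_comp, Category.assoc]
      homEquiv_naturality_right := fun φ α => toSkyscraper_comp φ α }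

end Adjunction

/-! ### Products of `G`-sheaves -/

section SmoothGerms

variable {R G X Y : Type u} [Ring R] [Group G] [TopologicalSpace G]
  [TopologicalSpace X] [TopologicalSpace Y] [MulAction G X] [MulAction G Y]

/-- The section `s` over preimages of neighbourhoods of `x` is invariant under translation by some
neighbourhood of `1`, uniformly on the preimage of some neighbourhood of `x`. -/
def IsSmoothNear (E : GSheaf R G Y) (f : Y → X) (x : X) (s : ∀ y, E.stalk y) : Prop :=
  ∀ᶠ q : G × Y in 𝓝 1 ×ˢ comap f (𝓝 x), E.translate q.1 s q.2 = s q.2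

/-- The germs at `x` of the sections that are invariant under translation by some neighbourhood
of `1`. For compact `Y` and Hausdorff `X` these are all germs, by `eventually_translate_eq`. -/
def smoothStalk (E : GSheaf R G Y) (f : Y → X) (x : X) : Submodule R (PushStalk E f x) where
  carrier := {e | ∃ s, germ E f x s = e ∧ IsSmoothNear E f x s.1}
  zero_mem' := ⟨0, rfl, Eventually.of_forall fun q => by simp⟩
  add_mem' := by
    rintro _ _ ⟨s, rfl, hs⟩ ⟨t, rfl, ht⟩
    refine ⟨s + t, rfl, ?_⟩
    filter_upwards [hs, ht] with q h1 h2
    simp [h1, h2]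
  smul_mem' := by
    rintro r _ ⟨s, rfl, hs⟩
    refine ⟨r • s, rfl, ?_⟩
    filter_upwards [hs] with q h1
    simp [h1]

theorem isOpen_smoothStalk (E : GSheaf R G Y) (f : Y → X) :
    IsOpen {e : Σ x, PushStalk E f x | e.2 ∈ smoothStalk E f e.1} := by
  rw [isOpen_iff_mem_nhds]
  rintro ⟨x, e⟩ (he : e ∈ smoothStalk E f x)
  obtain ⟨s, rfl, hs⟩ := he
  obtain ⟨N, hN, W, hW, hNW⟩ := mem_prod_iff.1 hs
  obtain ⟨U₁, ho₁, hx₁, h₁⟩ := eventually_comap_nhds (x := x) (P := fun y => y ∈ W) hW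
  obtain ⟨U₂, hs₂, ho₂, hx₂⟩ := exists_sheet E f x s
  have hst : ∀ x ∈ U₁ ∩ U₂, s.1 ∈ sectionsNear E f x := fun x hx => hs₂ x hx.2
  refine mem_of_superset ((isOpen_sheet E f (ho₁.inter ho₂) s.1 hst).mem_nhds
    ⟨⟨x, hx₁, hx₂⟩, rfl⟩) ?_
  rintro _ ⟨⟨z, hz⟩, rfl⟩
  exact ⟨⟨s.1, hst z hz⟩, rfl, mem_prod_iff.2 ⟨N, hN, W, h₁ z hz.1, hNW⟩⟩

variable [IsTopologicalGroup G] [ContinuousSMul G X] [ContinuousSMul G Y]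

theorem IsSmoothNear.translate {E : GSheaf R G Y} {f : Y → X}
    (hf : ∀ (g : G) y, f (g • y) = g • f y) {x x' : X} {s : ∀ y, E.stalk y}
    (hs : IsSmoothNear E f x s) (g : G) (h : g • x = x') :
    IsSmoothNear E f x' (E.translate g s) := by
  have h1 : Tendsto (fun k : G => g⁻¹ * k * g) (𝓝 1) (𝓝 1) := by
    have : Continuous fun k : G => g⁻¹ * k * g := by fun_prop
    simpa using this.tendsto 1
  have h2 := (h1.prodMap (tendsto_translate hf g h)).eventually hs
  filter_upwards [h2]
  rintro ⟨k, y⟩ hk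
  calc E.translate k (E.translate g s) y
      = E.translate g (E.translate (g⁻¹ * k * g) s) y := by
        rw [← E.translate_mul, ← E.translate_mul]
        group
    _ = E.translate g s y := congrArg (E.act g (g⁻¹ • y) y (smul_inv_smul g y)) hk

theorem IsSmoothNear.continuousAt_act {E : GSheaf R G Y} {f : Y → X}
    (hf : ∀ (g : G) y, f (g • y) = g • f y) {x : X} {s : sectionsNear E f x}
    (hs : IsSmoothNear E f x s.1) (g : G) :
    ContinuousAt (fun q : G × (Σ x, PushStalk E f x) =>
      (⟨q.1 • q.2.1, pushAct E hf q.1 q.2.1 (q.1 • q.2.1) rfl q.2.2⟩ :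
        Σ x, PushStalk E f x)) (g, ⟨x, germ E f x s⟩) := by
  obtain ⟨N, hN, W, hW, hNW⟩ := mem_prod_iff.1 hs
  obtain ⟨U₁, ho₁, hx₁, h₁⟩ := eventually_comap_nhds (x := x) (P := fun y => y ∈ W) hW
  obtain ⟨U₂, hs₂, ho₂, hx₂⟩ := exists_sheet E f x s
  obtain ⟨U, ht, ho, hx⟩ := exists_sheet E f (g • x)
    ⟨E.translate g s.1, translate_mem E hf g rfl s.2⟩
  have hcp := push_continuous_fst E f
  have c1 : ∀ᶠ q : G × (Σ x, PushStalk E f x) in 𝓝 (g, ⟨x, germ E f x s⟩),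
      q.1 • q.2.1 ∈ U :=
    (continuous_fst.smul (hcp.comp continuous_snd)).continuousAt.eventually_mem (ho.mem_nhds hx)
  have c2 : ∀ᶠ q : G × (Σ x, PushStalk E f x) in 𝓝 (g, ⟨x, germ E f x s⟩),
      g⁻¹ * q.1 ∈ N := by
    have hcont : Continuous fun q : G × (Σ x, PushStalk E f x) => g⁻¹ * q.1 :=
      continuous_const.mul continuous_fst
    exact hcont.continuousAt.eventually_mem (by simpa using hN)
  have c3 : ∀ᶠ q : G × (Σ x, PushStalk E f x) in 𝓝 (g, ⟨x, germ E f x s⟩),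
      g⁻¹ • q.1 • q.2.1 ∈ U₁ := by
    have hcont : Continuous fun q : G × (Σ x, PushStalk E f x) => g⁻¹ • q.1 • q.2.1 :=
      continuous_const.smul (continuous_fst.smul (hcp.comp continuous_snd))
    exact hcont.continuousAt.eventually_mem (by simpa using ho₁.mem_nhds hx₁)
  have c4 : ∀ᶠ q : G × (Σ x, PushStalk E f x) in 𝓝 (g, ⟨x, germ E f x s⟩),
      q.2 ∈ sheet E f U₂ s.1 hs₂ :=
    continuous_snd.continuousAt.eventually_mem
      ((isOpen_sheet E f ho₂ s.1 hs₂).mem_nhds ⟨⟨x, hx₂⟩, rfl⟩)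
  refine continuousAt_of_sheet (push_isOpenMap_fst E f)
    (continuous_fst.smul (hcp.comp continuous_snd)).continuousAt
    (isOpen_sheet E f ho _ ht) (injOn_sheet E f _ ht) ?_
  filter_upwards [c1, c2, c3, c4]
  rintro ⟨g', _⟩ h1 h2 h3 ⟨⟨x', hx'⟩, rfl⟩
  refine (mem_sheet E f _ ht _ ⟨E.translate g' s.1, translate_mem E hf g' rfl (hs₂ x' hx')⟩).2
    ⟨h1, ?_⟩
  have h6 : ∀ᶠ y in comap f (𝓝 (g' • x')), g⁻¹ • y ∈ W :=
    (tendsto_translate hf g (smul_inv_smul g (g' • x'))).eventually (h₁ _ h3)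
  filter_upwards [h6] with y h8
  have h9 : E.translate (g⁻¹ * g') s.1 (g⁻¹ • y) = s.1 (g⁻¹ • y) :=
    hNW (Set.mk_mem_prod h2 h8)
  -- Write `g' = g (g⁻¹ g')`, where `g⁻¹ g'` is close to `1` and hence fixes `s` near `g⁻¹ y`.
  calc E.translate g' s.1 y = E.translate g (E.translate (g⁻¹ * g') s.1) y := by
        rw [← E.translate_mul, mul_inv_cancel_left]
    _ = E.translate g s.1 y := congrArg (E.act g (g⁻¹ • y) y (smul_inv_smul g y)) h9

/-- The push forward of a `G`-sheaf along an equivariant map from a space that need not be compact: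
its stalks consist of the germs of sections that are invariant under translation by some
neighbourhood of `1`, as `G` need not act continuously on the space of all germs. -/
def smoothPushForward {f : Y → X} (hf : ∀ (g : G) y, f (g • y) = g • f y) (E : GSheaf R G Y) :
    GSheaf R G X :=
  GSheaf.ofOpenSubmodules (push_isLocalHomeomorph E f) (push_continuous_sub E f)
    (push_continuous_smul E f) (pushAct E hf)
    (fun x h e => by
      obtain ⟨s, rfl⟩ := germ_surj E f x e
      rw [pushAct_germ]
      congr 1
      exact Subtype.ext (E.translate_one s.1))
    (fun g k x y z hk hg hgk e => by
      obtain ⟨s, rfl⟩ := germ_surj E f x e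
      rw [pushAct_germ, pushAct_germ, pushAct_germ]
      congr 1
      exact Subtype.ext (E.translate_mul g k s.1))
    (smoothStalk E f) (isOpen_smoothStalk E f)
    (by
      rintro g x y h _ ⟨s, rfl, hs⟩
      exact ⟨_, (pushAct_germ E hf g x y h s).symm, hs.translate hf g h⟩)
    (by
      rintro g x _ ⟨s, rfl, hs⟩
      exact hs.continuousAt_act hf g)

variable [CompactSpace X] [T2Space X]

/-- Sections of a `G`-sheaf over the compact space `X` are uniformly invariant under small
translations, and so are their images under a cohomomorphism. Thus the smooth push forward has the
universal property of a push forward. -/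
theorem Cohomomorphism.toPush_mem_smoothStalk {K : GSheaf R G X} {E : GSheaf R G Y} {f : Y → X}
    (hf : ∀ (g : G) y, f (g • y) = g • f y) (ψ : Cohomomorphism K E f) (x : X) (e : K.stalk x) :
    ψ.toPush x e ∈ smoothStalk E f x := by
  obtain ⟨s, hs, rfl⟩ := K.exists_section x e
  rw [ψ.toPush_apply hs]
  refine ⟨_, rfl, ?_⟩
  have h1 := eventually_translate_eq K continuous_id hs.mem_sectionsNear_id
  rw [comap_id] at h1
  have h2 : Tendsto (Prod.map id f : G × Y → G × X) (𝓝 1 ×ˢ comap f (𝓝 x)) (𝓝 1 ×ˢ 𝓝 x) :=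
    tendsto_id.prodMap tendsto_comap
  filter_upwards [h2.eventually h1]
  rintro ⟨g, y⟩ h
  rw [← ψ.mapSection_translate hf]
  exact congrArg (ψ.app y) h

/-- The map to the smooth push forward adjoint to a cohomomorphism. -/
noncomputable def Cohomomorphism.toSmoothPush {K : GSheaf R G X} {E : GSheaf R G Y} {f : Y → X}
    (hf : ∀ (g : G) y, f (g • y) = g • f y) (ψ : Cohomomorphism K E f) :
    K ⟶ smoothPushForward hf E :=
  { app := fun x => (ψ.toPush x).codRestrict _ (ψ.toPush_mem_smoothStalk hf x)
    continuous_app := continuous_induced_rng.2 ψ.toPush_continuous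
    app_act := fun g x y h e => Subtype.ext (ψ.toPush_act hf g x y h e) }

end SmoothGerms

section DisjointUnion

variable {R G X O : Type u} [Ring R] [Group G] [TopologicalSpace G]
  [TopologicalSpace X] [MulAction G X] (E : O → GSheaf R G X)

/-- The fibres of the disjoint union of the `E o`, as a sheaf over the disjoint union of copies
of `X`. -/
abbrev SumStalk (y : Σ _ : O, X) : Type u := (E y.1).stalk y.2

/-- The total space of the disjoint union of the sheaves `E o` is the disjoint union of their
total spaces. -/
def sumTotalEquiv : (Σ y, SumStalk E y) ≃ Σ o, (E o).Total where
  toFun e := ⟨e.1.1, e.1.2, e.2⟩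
  invFun e := ⟨⟨e.1, e.2.1⟩, e.2.2⟩
  left_inv _ := rfl
  right_inv _ := rfl

instance sumTop : TopologicalSpace (Σ y, SumStalk E y) :=
  TopologicalSpace.induced (sumTotalEquiv E) inferInstance

/-- `sumTotalEquiv` as a homeomorphism. -/
def sumTotalHomeomorph : (Σ y, SumStalk E y) ≃ₜ Σ o, (E o).Total :=
  (sumTotalEquiv E).toHomeomorphOfIsInducing ⟨rfl⟩

/-- The inclusion of the total space of a summand. -/
def sumIncl (o : O) (e : (E o).Total) : Σ y, SumStalk E y := ⟨⟨o, e.1⟩, e.2⟩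

theorem sumIncl_isOpenEmbedding (o : O) : IsOpenEmbedding (sumIncl E o) :=
  (sumTotalHomeomorph E).symm.isOpenEmbedding.comp IsOpenEmbedding.sigmaMk

theorem sum_isLocalHomeomorph :
    IsLocalHomeomorph (Sigma.fst : (Σ y, SumStalk E y) → Σ _ : O, X) := by
  have hp : (Sigma.fst : (Σ y, SumStalk E y) → Σ _ : O, X) =
      (fun e : Σ o, (E o).Total => (⟨e.1, e.2.1⟩ : Σ _ : O, X)) ∘ sumTotalHomeomorph E := rfl
  have hl := fun o => (E o).isLocalHomeomorph
  refine isLocalHomeomorph_of_sheets ?_ ?_ ?_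
  · rw [hp]
    refine Continuous.comp ?_ (sumTotalHomeomorph E).continuous
    exact continuous_sigma fun o => continuous_sigmaMk.comp (hl o).continuous
  · rw [hp]
    refine IsOpenMap.comp ?_ (sumTotalHomeomorph E).isOpenMap
    exact isOpenMap_sigma.2 fun o => isOpenMap_sigmaMk.comp (hl o).isOpenMap
  · rintro ⟨⟨o, x⟩, e⟩
    obtain ⟨φ, hφ, h⟩ := hl o ⟨x, e⟩
    refine ⟨sumIncl E o '' φ.source,
      (sumIncl_isOpenEmbedding E o).isOpenMap _ φ.open_source, ⟨_, hφ, rfl⟩, ?_⟩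
    rintro _ ⟨a, ha, rfl⟩ _ ⟨b, hb, rfl⟩ hab
    have h1 : a.1 = b.1 := eq_of_heq (Sigma.mk.inj hab).2
    rw [φ.injOn ha hb (by rwa [← h])]

theorem sum_continuous_sub : Continuous[fibreSquareTop (SumStalk E) (sumTop E), sumTop E]
    fun q => ⟨q.1, q.2.1 - q.2.2⟩ := by
  let _ := fibreSquareTop (SumStalk E) (sumTop E)
  let _ := fun o => fibreSquareTop (E o).stalk (E o).top
  let i : (Σ y, SumStalk E y × SumStalk E y) → (Σ y, SumStalk E y) × (Σ y, SumStalk E y) :=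
    fun q => (⟨q.1, q.2.1⟩, ⟨q.1, q.2.2⟩)
  let i' : ∀ o, (Σ x, (E o).stalk x × (E o).stalk x) → (E o).Total × (E o).Total :=
    fun o q => (⟨q.1, q.2.1⟩, ⟨q.1, q.2.2⟩)
  have hi' : ∀ o, IsInducing (i' o) := fun o => ⟨rfl⟩
  let j := fun (o : O) (q : Σ x, (E o).stalk x × (E o).stalk x) =>
    (⟨⟨o, q.1⟩, q.2⟩ : Σ y, SumStalk E y × SumStalk E y)
  have hi : IsInducing i := ⟨rfl⟩
  have hj : ∀ o, IsOpenEmbedding (j o) := by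
    intro o
    refine ⟨⟨?_, ?_⟩, ?_⟩
    · rw [← hi.of_comp_iff]
      exact ((sumIncl_isOpenEmbedding E o).isInducing.prodMap
        (sumIncl_isOpenEmbedding E o).isInducing).comp (hi' o)
    · rintro ⟨x, e⟩ ⟨x', e'⟩ h
      obtain rfl : x = x' := eq_of_heq (Sigma.mk.inj (congrArg Sigma.fst h)).2
      obtain rfl : e = e' := eq_of_heq (Sigma.mk.inj h).2
      rfl
    · have h1 : Set.range (j o) = (fun q => (i q).1) ⁻¹' Set.range (sumIncl E o) := by
        ext ⟨⟨o', x⟩, e⟩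
        constructor
        · rintro ⟨q, h⟩
          rw [← h]
          exact ⟨⟨q.1, q.2.1⟩, rfl⟩
        · rintro ⟨q, h⟩
          obtain rfl : o = o' := congrArg (fun e => e.1.1) h
          exact ⟨⟨x, e⟩, rfl⟩
      rw [h1]
      exact (sumIncl_isOpenEmbedding E o).isOpen_range.preimage (continuous_fst.comp hi.continuous)
  rw [continuous_iff_continuousAt]
  rintro ⟨⟨o, x⟩, e⟩
  refine ((hj o).continuousAt_iff (x := ⟨x, e⟩)).1 ?_
  exact ((sumIncl_isOpenEmbedding E o).continuous.comp (E o).continuous_sub).continuousAt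

theorem sum_continuous_smul (r : R) :
    Continuous fun e : Σ y, SumStalk E y => (⟨e.1, r • e.2⟩ : Σ y, SumStalk E y) := by
  rw [continuous_iff_continuousAt]
  rintro ⟨⟨o, x⟩, e⟩
  refine ((sumIncl_isOpenEmbedding E o).continuousAt_iff (x := ⟨x, e⟩)).1 ?_
  exact ((sumIncl_isOpenEmbedding E o).continuous.comp ((E o).continuous_smul r)).continuousAt

/-- The action on the disjoint union of the sheaves `E o`. The points `y` and `g • y` lie in the
same copy of `X`, so matching on the equation removes the need for casts. -/
def sumAct (g : G) : ∀ y y' : Σ _ : O, X, g • y = y' → (SumStalk E y →ₗ[R] SumStalk E y')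
  | ⟨o, x⟩, _, rfl => (E o).act g x (g • x) rfl

theorem sumAct_mk (g : G) (o : O) {x x' : X} (h : g • x = x')
    (h' : g • (⟨o, x⟩ : Σ _ : O, X) = ⟨o, x'⟩) (e : (E o).stalk x) :
    sumAct E g ⟨o, x⟩ ⟨o, x'⟩ h' e = (E o).act g x x' h e := by
  subst h
  rfl

/-- The disjoint union of the sheaves `E o`, over the disjoint union of copies of `X`. -/
def sumSheaf : GSheaf R G (Σ _ : O, X) where
  stalk := SumStalk E
  isLocalHomeomorph := sum_isLocalHomeomorph E
  continuous_sub := sum_continuous_sub E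
  continuous_smul := sum_continuous_smul E
  act := sumAct E
  act_one := by
    rintro ⟨o, x⟩ h e
    rw [sumAct_mk E 1 o (one_smul G x), (E o).act_one]
  act_mul := by
    rintro g k ⟨o, x⟩ _ _ rfl rfl hgk e
    exact (sumAct_mk E (g * k) o (mul_smul g k x) hgk e).trans ((E o).act_mul g k _ _ _ rfl rfl _ e)
  continuous_act := by
    rw [continuous_iff_continuousAt]
    rintro ⟨g, ⟨⟨o, x⟩, e⟩⟩
    refine ((IsOpenEmbedding.id.prodMap (sumIncl_isOpenEmbedding E o)).continuousAt_iff
      (x := (g, ⟨x, e⟩))).1 ?_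
    exact ((sumIncl_isOpenEmbedding E o).continuous.comp (E o).continuous_act).continuousAt

instance [ContinuousSMul G X] : ContinuousSMul G (Σ _ : O, X) where
  continuous_smul := by
    rw [continuous_iff_continuousAt]
    rintro ⟨g, ⟨o, x⟩⟩
    refine ((IsOpenEmbedding.id.prodMap
      (IsOpenEmbedding.sigmaMk (σ := fun _ : O => X) (i := o))).continuousAt_iff
      (x := (g, x))).1 ?_
    exact (continuous_sigmaMk.comp continuous_smul).continuousAt

end DisjointUnion

section Products

variable {R G X O : Type u} [Ring R] [Group G] [TopologicalSpace G] [IsTopologicalGroup G]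
  [TopologicalSpace X] [CompactSpace X] [T2Space X] [MulAction G X] [ContinuousSMul G X]
  (E : O → GSheaf R G X)

/-- The folding map from the disjoint union of copies of `X` to `X`. -/
abbrev fold (O X : Type u) : (Σ _ : O, X) → X := Sigma.snd

theorem fold_smul (g : G) (y : Σ _ : O, X) : fold O X (g • y) = g • fold O X y := rfl

/-- The product of the sheaves `E o`: its elements at `x` are the germs of families of sections
of the `E o` over a common neighbourhood of `x` that are invariant under translation by a common
neighbourhood of `1`. -/
def prodSheaf : GSheaf R G X := smoothPushForward fold_smul (sumSheaf E)

theorem continuous_germEval_fold (o : O) :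
    Continuous fun e : Σ x, PushStalk (sumSheaf E) (fold O X) x =>
      (⟨e.1, germEval (sumSheaf E) (fold O X) ⟨o, e.1⟩ e.2⟩ : (E o).Total) := by
  rw [continuous_iff_continuousAt]
  rintro ⟨x, e⟩
  obtain ⟨t, rfl⟩ := germ_surj (sumSheaf E) (fold O X) x e
  obtain ⟨U, ht, hU, hx⟩ := exists_sheet (sumSheaf E) (fold O X) x t
  have h1 : ContinuousAt (fun y => (⟨y, t.1 y⟩ : (sumSheaf E).Total)) ⟨o, x⟩ := by
    have h : ∀ᶠ y in comap (fold O X) (𝓝 x),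
      ContinuousAt (fun y => (⟨y, t.1 y⟩ : (sumSheaf E).Total)) y := t.2
    exact (tendsto_comap_iff.2 (tendsto_pure_nhds (fold O X) ⟨o, x⟩)).eventually h
  have h2 : ContinuousAt (fun z => (⟨z, t.1 ⟨o, z⟩⟩ : (E o).Total)) x := by
    rw [(sumIncl_isOpenEmbedding E o).isInducing.continuousAt_iff]
    exact ContinuousAt.comp (f := fun z : X => (⟨o, z⟩ : Σ _ : O, X)) h1
      continuous_sigmaMk.continuousAt
  have h3 : ContinuousAt (fun e : Σ x, PushStalk (sumSheaf E) (fold O X) x =>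
      (⟨e.1, t.1 ⟨o, e.1⟩⟩ : (E o).Total)) ⟨x, germ _ _ x t⟩ :=
    ContinuousAt.comp (f := fun e : Σ x, PushStalk (sumSheaf E) (fold O X) x => e.1)
      (g := fun z => (⟨z, t.1 ⟨o, z⟩⟩ : (E o).Total)) h2
      (push_continuous_fst _ _).continuousAt
  refine h3.congr ?_
  filter_upwards [(isOpen_sheet _ _ hU t.1 ht).mem_nhds ⟨⟨x, hx⟩, rfl⟩]
  rintro _ ⟨⟨z, hz⟩, rfl⟩
  rfl

/-- The projection to a factor is the evaluation of germs. -/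
def prodProj (o : O) : prodSheaf E ⟶ E o :=
  { app := fun x => (germEval (sumSheaf E) (fold O X) ⟨o, x⟩).comp
      (smoothStalk (sumSheaf E) (fold O X) x).subtype
    continuous_app := (continuous_germEval_fold E o).comp
      (f := fun e : (prodSheaf E).Total =>
        (⟨e.1, e.2.1⟩ : Σ x, PushStalk (sumSheaf E) (fold O X) x)) continuous_induced_dom
    app_act := fun g x x' h e => by
      have h' : g • (⟨o, x⟩ : Σ _ : O, X) = ⟨o, x'⟩ := by rw [← h]; rfl
      exact (germEval_pushAct (sumSheaf E) fold_smul g h' h e.1).trans (sumAct_mk E g o h h' _) }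

variable {E}

/-- A family of maps to the `E o`, as a cohomomorphism along the folding map. -/
def sumCohom {K : GSheaf R G X} (φ : ∀ o, K ⟶ E o) :
    Cohomomorphism K (sumSheaf E) (fold O X) where
  app y := (φ y.1).app y.2
  continuousAt_app := by
    rintro ⟨o, x⟩ s hs
    refine (IsOpenEmbedding.sigmaMk.continuousAt_iff).1 ?_
    exact ((sumIncl_isOpenEmbedding E o).continuous.comp (φ o).continuous_app).continuousAt.comp
      (f := fun z => (⟨z, s z⟩ : K.Total)) hs.continuousAt
  app_act := by
    rintro g ⟨o, x⟩ _ rfl h' e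
    exact (φ o).app_act g x (g • x) h' e

/-- The map to the product with given components. -/
noncomputable def prodLift {K : GSheaf R G X} (φ : ∀ o, K ⟶ E o) : K ⟶ prodSheaf E :=
  (sumCohom φ).toSmoothPush fold_smul

theorem prodLift_proj {K : GSheaf R G X} (φ : ∀ o, K ⟶ E o) (o : O) :
    prodLift φ ≫ prodProj E o = φ o :=
  GSheaf.hom_ext _ _ fun x e => (sumCohom φ).germEval_toPush ⟨o, x⟩ e

theorem eq_prodLift {K : GSheaf R G X} (φ : ∀ o, K ⟶ E o) (θ : K ⟶ prodSheaf E)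
    (h : ∀ o, θ ≫ prodProj E o = φ o) : θ = prodLift φ :=
  GSheaf.hom_ext _ _ fun x e => Subtype.ext <| Eq.symm <|
    (sumCohom φ).eq_toPush (θ := fun x e => (θ.app x e).1)
      (continuous_induced_dom.comp θ.continuous_app)
      (fun y e => congrArg (fun γ : K.Hom (E y.1) => γ.app y.2 e) (h y.1)) x e

theorem hasProduct : HasProduct E :=
  ⟨⟨⟨Fan.mk (prodSheaf E) (prodProj E), Fan.IsLimit.mk _ (fun s => prodLift s.proj)
    (fun s o => prodLift_proj s.proj o) (fun s m h => eq_prodLift s.proj m h)⟩⟩⟩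

end Products

/-! ### Embedding into products of skyscrapers -/

section Injectives

variable {R G X : Type u} [Ring R] [Group G] [TopologicalSpace G] [TopologicalSpace X]
  [MulAction G X]

/-- A map of `G`-sheaves is determined by its values on one stalk for each orbit. -/
theorem GSheaf.hom_ext_of_representatives {rep : MulAction.orbitRel.Quotient G X → X}
    (hrep : ∀ o, (Quotient.mk'' (rep o) : MulAction.orbitRel.Quotient G X) = o)
    {K E : GSheaf R G X} (α β : K ⟶ E) (h : ∀ o e, α.app (rep o) e = β.app (rep o) e) :
    α = β := by
  refine GSheaf.hom_ext _ _ fun z e => ?_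
  obtain ⟨g, hg⟩ : z ∈ MulAction.orbit G (rep (Quotient.mk'' z)) :=
    MulAction.orbitRel_apply.1 (Quotient.exact (hrep (Quotient.mk'' z)).symm)
  have h1 : g⁻¹ • z = rep (Quotient.mk'' z) := inv_smul_eq_iff.2 hg.symm
  have h2 : K.act g _ z hg (K.act g⁻¹ z _ h1 e) = e :=
    (K.act_act h1 hg (one_smul G z) (mul_inv_cancel g) e).trans (K.act_one z _ e)
  rw [← h2, α.app_act, β.app_act, h]

variable [IsTopologicalGroup G] [CompactSpace G] [CompactSpace X] [T2Space X] [ContinuousSMul G X]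

theorem injective_skyscraper (x : X) (A : DiscreteModule R (MulAction.stabilizer G x))
    (hA : Injective A) : Injective ((skyscraper R G x).obj A) :=
  Injective.injective_of_adjoint (stalkSkyscraperAdj R G x) A

/-- The stalks of a `G`-sheaf at representatives of the orbits embed into injective modules. -/
theorem exists_mono_of_representatives {rep : MulAction.orbitRel.Quotient G X → X}
    (E : GSheaf R G X) :
    ∃ (I : ∀ o, DiscreteModule R (MulAction.stabilizer G (rep o)))
      (ι : ∀ o, (stalkFunctor R G (rep o)).obj E ⟶ I o), ∀ o, Injective (I o) ∧ Mono (ι o) :=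
  ⟨fun _ => Injective.under _, fun _ => Injective.ι _, fun _ => ⟨inferInstance, inferInstance⟩⟩

/-- A family of monomorphisms from the stalks at representatives of the orbits is adjoint to a
monomorphism to the product of the skyscrapers: two maps to the sheaf that become equal in the
product agree on the stalks at the representatives, hence on all stalks by equivariance. -/
theorem mono_lift_of_representatives {rep : MulAction.orbitRel.Quotient G X → X}
    (hrep : ∀ o, (Quotient.mk'' (rep o) : MulAction.orbitRel.Quotient G X) = o)
    (E : GSheaf R G X) (I : ∀ o, DiscreteModule R (MulAction.stabilizer G (rep o)))
    (ι : ∀ o, (stalkFunctor R G (rep o)).obj E ⟶ I o) [∀ o, Mono (ι o)]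
    [HasProduct fun o => (skyscraper R G (rep o)).obj (I o)] :
    Mono (Pi.lift fun o => (stalkSkyscraperAdj R G (rep o)).homEquiv E (I o) (ι o)) := by
  refine ⟨fun {K} α β h => GSheaf.hom_ext_of_representatives hrep α β fun o e => ?_⟩
  have h1 := congrArg (fun γ => γ ≫ Pi.π _ o) h
  simp only [Category.assoc, Pi.lift_π] at h1
  rw [← Adjunction.homEquiv_naturality_left, ← Adjunction.homEquiv_naturality_left,
    Equiv.apply_eq_iff_eq, cancel_mono] at h1
  exact congrArg (fun γ : (stalkFunctor R G (rep o)).obj K ⟶ (stalkFunctor R G (rep o)).obj E =>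
    γ.hom.hom.hom e) h1

variable (R G X) in
theorem enoughInjectives : EnoughInjectives (GSheaf R G X) where
  presentation E := by
    have hrep : ∀ o : MulAction.orbitRel.Quotient G X, (Quotient.mk'' o.out : _) = o :=
      Quotient.out_eq'
    obtain ⟨I, ι, h⟩ := exists_mono_of_representatives (rep := Quotient.out) E
    have := fun o => (h o).2
    have := fun o => injective_skyscraper _ (I o) (h o).1
    have : HasProduct fun o => (skyscraper R G (Quotient.out o)).obj (I o) := hasProduct
    have := mono_lift_of_representatives hrep E I ι
    exact ⟨⟨_, inferInstance, _, this⟩⟩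

end Injectives

end EquivSheaf

theorem theorem9p2 {R G X : Type u} [Ring R]
    [Group G] [TopologicalSpace G] [IsTopologicalGroup G] [CompactSpace G] [T2Space G]
    [TotallyDisconnectedSpace G]
    [TopologicalSpace X] [CompactSpace X] [T2Space X] [TotallyDisconnectedSpace X]
    [MulAction G X] [ContinuousSMul G X] :
    (∃ adj : ∀ x : X, EquivSheaf.stalkFunctor R G x ⊣ EquivSheaf.skyscraper R G x,
      ∀ (rep : MulAction.orbitRel.Quotient G X → X)
        (_ : ∀ o, (Quotient.mk'' (rep o) : MulAction.orbitRel.Quotient G X) = o)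
        (E : EquivSheaf.GSheaf R G X),
        (∃ (I : ∀ o, EquivSheaf.DiscreteModule R (MulAction.stabilizer G (rep o)))
          (ι : ∀ o, (EquivSheaf.stalkFunctor R G (rep o)).obj E ⟶ I o),
          ∀ o, Injective (I o) ∧ Mono (ι o)) ∧
        ∀ (I : ∀ o, EquivSheaf.DiscreteModule R (MulAction.stabilizer G (rep o)))
          (ι : ∀ o, (EquivSheaf.stalkFunctor R G (rep o)).obj E ⟶ I o),
          (∀ o, Injective (I o) ∧ Mono (ι o)) →
          ∃ _ : HasProduct fun o => (EquivSheaf.skyscraper R G (rep o)).obj (I o),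
            Mono (Pi.lift fun o => (adj (rep o)).homEquiv E (I o) (ι o)) ∧
            Injective (∏ᶜ fun o => (EquivSheaf.skyscraper R G (rep o)).obj (I o))) ∧
    (∀ (x : X) (A : EquivSheaf.DiscreteModule R (MulAction.stabilizer G x)),
      Injective A → Injective ((EquivSheaf.skyscraper R G x).obj A)) ∧
    EnoughInjectives (EquivSheaf.GSheaf R G X) := by
  refine ⟨⟨fun x => EquivSheaf.stalkSkyscraperAdj R G x, fun rep hrep E =>
    ⟨EquivSheaf.exists_mono_of_representatives E, fun I ι h => ?_⟩⟩,
    EquivSheaf.injective_skyscraper, EquivSheaf.enoughInjectives R G X⟩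
  have := fun o => (h o).2
  have := fun o => EquivSheaf.injective_skyscraper _ (I o) (h o).1
  have hprod : HasProduct fun o => (EquivSheaf.skyscraper R G (rep o)).obj (I o) :=
    EquivSheaf.hasProduct
  exact ⟨hprod, EquivSheaf.mono_lift_of_representatives hrep E I ι,
    inferInstance⟩
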